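/- Let $\Delta$ be a finite abstract simplicial complex (a family of subsets of a finite set, closed under taking subsets, $\emptyset\in\Delta$) of dimension $d\ge 1$, where a simplex with $i+1$ elements has dimension $i$. Let $\Delta'$ be its barycentric subdivision, whose simplices are the finite sets of nonempty simplices of $\Delta$ that are totally ordered by inclusion, and let $\Delta^{(k)}$ be the $k$-times iterated barycentric subdivision. For a complex $\Gamma$ of dimension $e$ with $f_i^{\Gamma}$ simplices of dimension $i$ ($f_{-1}^\Gamma=1$), its $h$-polynomial is $h^{\Gamma}(z)=\sum_{i=-1}^{e} f_i^{\Gamma}(z-1)^{e-i}$. For $i,j\ge 0$ let $f_{i,j}$ be the number of chains $\sigma_0\subsetneq\cdots\subsetneq\sigma_i$ of nonempty subsets of a $(j+1)$-element set whose largest member $\sigma_i$ is the whole set. Put $F_{d,d}=1$, $F_{-1,d}=0$, and for $0\le i<d$ $$F_{i,d}=\sum_{\ell\ge 0}\ \sum_{i=i_0<i_1<\cdots<i_\ell<i_{\ell+1}=d}\ \prod_{j=0}^{\ell}\frac{f_{i_j,i_{j+1}}}{(d+1)!-(i_j+1)!}.$$ Let $F_d(z)=\sum_{i=-1}^{d}F_{i,d}z^{d-i}$,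 let $H_d(z)=F_d(z-1)$ be the $H$-polynomial, and define $H_{i,d}$ by $H_d(z)=\sum_{i=0}^{d+1}H_{i,d}z^{d+1-i}$. For every $k\ge 0$ let $\rho^{(k)}_\infty,\rho^{(k)}_0,\rho^{(k)}_1,\dots,\rho^{(k)}_{d-1}$ be the complex zeros, with multiplicity, of $h^{\Delta^{(k)}}(z)$, listed so that $\rho^{(k)}_\infty$ has the maximum and $\rho^{(k)}_0$ the minimum modulus among them. Then, as $k\to\infty$: 1. $\rho^{(k)}_0\to 0$; 2. after a suitable renumbering of $\rho^{(k)}_1,\dots,\rho^{(k)}_{d-1}$ for each $k$, each of the sequences $\rho^{(k)}_i$ $(1\le i\le d-1)$ converges in $\mathbb{C}$; 3. $\rho^{(k)}_\infty$ is real for all sufficiently large $k$, and $|\rho^{(k)}_\infty|\to\infty$; 4. the polynomials $\prod_{i=0}^{d-1}(z-\rho^{(k)}_i)$ converge (coefficientwise, and pointwise in $z\in\mathbb{C}$), and $$H_{1,d}\,\lim_{k\to\infty}\prod_{i=0}^{d-1}\bigl(z-\rho^{(k)}_i\bigr)=H_d(z);$$ 5. $\prod_{i=1}^{d-1}\rho^{(k)}_i\to(-1)^{d-1}$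 (an empty product being $1$). -/

import Mathlib

open Filter Topology Polynomial

namespace PreAbstractSimplicialComplex

/-- All simplices of `Δ`, the empty simplex included
(Mathlib's `faces` consists of the nonempty ones). -/
def simplices {ι : Type*} (Δ : PreAbstractSimplicialComplex ι) : Set (Finset ι) :=
  insert ∅ Δ.faces

/-- The barycentric subdivision: its vertices are the nonempty simplices of `Δ`, and its nonempty
simplices are the nonempty finite sets of nonempty simplices of `Δ` that are totally ordered
by inclusion. -/
def barycentricSubdivision {ι : Type*} (Δ : PreAbstractSimplicialComplex ι) :
    PreAbstractSimplicialComplex (Finset ι) where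
  faces := {C | C.Nonempty ∧ (∀ s ∈ C, s ∈ Δ.faces) ∧ IsChain (fun s t : Finset ι => s ⊆ t) (C : Set (Finset ι))}
  isRelLowerSet_faces := fun {_} hC =>
    ⟨hC.1, fun _ hDC hD =>
      ⟨hD, fun s hs => hC.2.1 s (hDC hs), hC.2.2.mono (Finset.coe_subset.mpr hDC)⟩⟩

/-- The vertex type of the `k`-th iterated barycentric subdivision. -/
def IterVertex (ι : Type*) : ℕ → Type _
  | 0 => ι
  | k + 1 => Finset (IterVertex ι k)

/-- The `k`-th iterated barycentric subdivision of `Δ`. -/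
def iterSubdivision {ι : Type*} (Δ : PreAbstractSimplicialComplex ι) :
    (k : ℕ) → PreAbstractSimplicialComplex (IterVertex ι k)
  | 0 => Δ
  | k + 1 => (iterSubdivision Δ k).barycentricSubdivision

/-- The largest cardinality of a simplex of `Δ`, that is, the dimension plus one
(meant for complexes with finitely many simplices). -/
noncomputable def maxCard {ι : Type*} (Δ : PreAbstractSimplicialComplex ι) : ℕ :=
  sSup (Finset.card '' Δ.simplices)

/-- The dimension; a simplex with `d + 1` vertices has dimension `d`. -/
noncomputable def dim {ι : Type*} (Δ : PreAbstractSimplicialComplex ι) : ℤ :=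
  (Δ.maxCard : ℤ) - 1

/-- The number of simplices of `Δ` with exactly `a` vertices, that is, of dimension `a - 1`. -/
noncomputable def numSimplices {ι : Type*} (Δ : PreAbstractSimplicialComplex ι) (a : ℕ) : ℕ :=
  {s : Finset ι | s ∈ Δ.simplices ∧ s.card = a}.ncard

/-- The `f`-polynomial `∑_{i=-1}^{d} f_i z^{d-i}` with `d = dim Δ`, where `f_i` is the number of
`i`-simplices; the summation index here is `a = i + 1`. -/
noncomputable def fPoly {ι : Type*} (Δ : PreAbstractSimplicialComplex ι) : ℤ[X] :=
  ∑ a ∈ Finset.range (Δ.maxCard + 1), C (Δ.numSimplices a : ℤ) * X ^ (Δ.maxCard - a)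

/-- The `h`-polynomial `h(z) = f(z - 1)`. -/
noncomputable def hPoly {ι : Type*} (Δ : PreAbstractSimplicialComplex ι) : ℤ[X] :=
  Δ.fPoly.comp (X - 1)

end PreAbstractSimplicialComplex

namespace Subdivision

/-- `chainCount (i + 1) (d + 1)` is the number `f_{i,d}`: for `i, d ≥ 0`, the number of
`i`-simplices of the barycentric subdivision of the standard `d`-simplex whose largest element is
the whole simplex; moreover `f_{-1,-1} = 1` and `f_{-1,d} = 0` for `d ≥ 0`. -/
noncomputable def chainCount (a b : ℕ) : ℕ :=
  if a = 0 then (if b = 0 then 1 else 0)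
  else {c : Finset (Finset (Fin b)) |
    c ∈ (⊤ : PreAbstractSimplicialComplex (Fin b)).barycentricSubdivision.faces ∧
      c.card = a ∧ Finset.univ ∈ c}.ncard

open scoped Classical in
/-- `FNum (i + 1) (d + 1)` is the number `F_{i,d}`: it is `1` for `i = d`, it is `0` for
`i = -1 < d`, and for `0 ≤ i < d` it is the sum over all strictly increasing sequences
`i = i_0 < i_1 < ⋯ < i_ℓ < i_{ℓ+1} = d`, `ℓ ≥ 0`, of the products
`∏_{j=0}^{ℓ} f_{i_j, i_{j+1}} / ((d + 1)! - (i_j + 1)!)`.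
In the formula `a = i + 1`, `b = d + 1`, and `s j = i_j + 1`. -/
noncomputable def FNum (a b : ℕ) : ℚ :=
  if a = b then 1
  else if a = 0 then 0
  else ∑ l ∈ Finset.range b, ∑ s : Fin (l + 2) → Fin (b + 1),
    if StrictMono s ∧ (s 0 : ℕ) = a ∧ (s (Fin.last (l + 1)) : ℕ) = b then
      ∏ j : Fin (l + 1), (chainCount (s j.castSucc) (s j.succ) : ℚ) /
        ((b.factorial : ℚ) - ((s j.castSucc : ℕ).factorial : ℚ))
    else 0

/-- The `F`-polynomial `F_d(z) = ∑_{i=-1}^{d} F_{i,d} z^{d-i}`; the summation index here is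
`a = i + 1`. -/
noncomputable def FPoly (d : ℕ) : ℚ[X] :=
  ∑ a ∈ Finset.range (d + 2), C (FNum a (d + 1)) * X ^ (d + 1 - a)

/-- The `H`-polynomial `H_d(z) = F_d(z - 1)`. -/
noncomputable def HPoly (d : ℕ) : ℚ[X] :=
  (FPoly d).comp (X - 1)

/-- The numbers `H_{i,d}`, `0 ≤ i ≤ d + 1`, determined by
`H_d(z) = ∑_{i=0}^{d+1} H_{i,d} z^{d+1-i}`. -/
noncomputable def HNum (i d : ℕ) : ℚ :=
  (HPoly d).coeff (d + 1 - i)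

end Subdivision

/-! ### Chains and the face numbers of one barycentric subdivision. -/

namespace Subdivision

/-! Put n = d + 1. Sorting the chains of a subdivision by their largest member shows that face
numbers transform linearly by the matrix `chainCount`, which is triangular with diagonal entries a!.
On indices up to n ≥ 2 the eigenvalue n! is simple and dominant, and the numbers `FNum a n` form its
eigenvector. Hence the face numbers of the k-th subdivision, divided by n!^k, tend to a positive
multiple of them (`tendsto_numSimplices_iterSubdivision`). So the monic h-polynomials, scaled by
some ε_k → 0, tend coefficientwise to H_d, whose degree is only d because `FNum 0 n = 0` and `FNum 1
n > 0`.

Losing one degree means that exactly one root escapes, asymptotic to -H_{1,d}/ε_k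
(`tendsto_mul_of_norm_le`). Dividing it out leaves monic polynomials converging to H_d/H_{1,d}, and
continuity of roots (`exists_perm_tendsto_roots`) makes the other roots converge. The escaping root
is eventually alone in its modulus, so it equals its complex conjugate.

The root 0 and the product of the remaining limits come from a Dehn–Sommerville symmetry.
Subdivision, acting on generating polynomials, commutes with X ↦ -1 - X (`subdivisionMap_reflect`),
so the simple eigenvector is symmetric up to the sign (-1)^n (`limitPoly_comp`). Therefore H_d has
constant coefficient 0, and its linear coefficient equals its coefficient in degree d. -/

theorem chainCount_zero_left (b : ℕ) : chainCount 0 b = if b = 0 then 1 else 0 := by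
  simp [chainCount]

theorem chainCount_succ_zero (a : ℕ) : chainCount (a + 1) 0 = 0 := by
  rw [chainCount, if_neg (Nat.succ_ne_zero a), Set.ncard_eq_zero (Set.toFinite _)]
  ext c
  simp only [Set.mem_ofPred_eq, Set.mem_empty_iff_false, iff_false]
  rintro ⟨⟨-, h, -⟩, -, hu⟩
  have := h _ hu
  rw [Finset.univ_eq_empty] at this
  exact Finset.not_nonempty_empty this

end Subdivision

namespace PreAbstractSimplicialComplex

/-- The chains of `a` nonempty finite sets with largest member `T`. -/
def chainsTo {ι : Type*} (a : ℕ) (T : Finset ι) : Set (Finset (Finset ι)) :=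
  {c | T ∈ c ∧ (∀ s ∈ c, s.Nonempty ∧ s ⊆ T) ∧
    IsChain (fun s t : Finset ι => s ⊆ t) (c : Set (Finset ι)) ∧ c.card = a}

theorem finite_chainsTo {ι : Type*} (a : ℕ) (T : Finset ι) : (chainsTo a T).Finite := by
  refine (Finset.finite_toSet T.powerset.powerset).subset fun c hc => ?_
  simp only [Finset.mem_coe, Finset.mem_powerset]
  intro s hs
  exact Finset.mem_powerset.2 (hc.2.1 s hs).2

theorem exists_greatest_of_isChain {ι : Type*} {c : Finset (Finset ι)} (hne : c.Nonempty)
    (hc : IsChain (fun s t : Finset ι => s ⊆ t) (c : Set (Finset ι))) :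
    ∃ T ∈ c, ∀ s ∈ c, s ⊆ T := by
  obtain ⟨T, hT, hmax⟩ := c.exists_maximal hne
  refine ⟨T, hT, fun s hs => ?_⟩
  rcases hc.total hs hT with h | h
  · exact h
  · exact hmax hs h

theorem chainsTo_map {α β : Type*} (g : α ↪ β) (a : ℕ) (T : Finset α) :
    chainsTo a (T.map g) =
      Finset.map (Finset.mapEmbedding g).toEmbedding '' chainsTo a T := by
  classical
  ext c
  constructor
  · rintro ⟨hT, hs, hc, ha⟩
    have hsub : (c : Set (Finset β)) ⊆ (fun s : Finset α => s.map g) '' Set.univ := by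
      intro s hsc
      obtain ⟨u, -, hu⟩ := Finset.subset_map_iff.1 (hs s hsc).2
      exact ⟨u, trivial, hu.symm⟩
    obtain ⟨c', -, rfl⟩ := Finset.subset_set_image_iff.1 hsub
    have hinj : Function.Injective (fun s : Finset α => s.map g) := Finset.map_injective g
    refine ⟨c', ⟨?_, ?_, ?_, ?_⟩, ?_⟩
    · obtain ⟨u, hu, hu'⟩ := Finset.mem_image.1 hT
      rwa [← hinj hu']
    · intro s hsc
      have := hs (s.map g) (Finset.mem_image_of_mem _ hsc)
      simpa using this
    · intro s hsc t htc hst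
      have := hc (x := s.map g) (by simpa using hsc) (y := t.map g)
        (by simpa using htc) (fun h => hst (hinj h))
      simpa using this
    · rw [← ha, Finset.card_image_of_injective _ hinj]
    · rw [Finset.map_eq_image]; rfl
  · rintro ⟨c', ⟨hT, hs, hc, ha⟩, rfl⟩
    refine ⟨?_, ?_, ?_, by simpa using ha⟩
    · exact Finset.mem_map.2 ⟨T, hT, rfl⟩
    · intro s hsc
      obtain ⟨u, hu, rfl⟩ := Finset.mem_map.1 hsc
      have := hs u hu
      simpa using this
    · intro s hsc t htc hst
      obtain ⟨u, hu, rfl⟩ := Finset.mem_map.1 (Finset.mem_coe.1 hsc)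
      obtain ⟨v, hv, rfl⟩ := Finset.mem_map.1 (Finset.mem_coe.1 htc)
      have := hc hu hv (fun h => hst (by rw [h]))
      simpa using this

/-- Transport along a bijection of `T` with `Fin T.card`. The case `a = 0` must be excluded:
`chainCount 0 0 = 1`, while `chainsTo 0 T` is empty. -/
theorem ncard_chainsTo {ι : Type*} (a : ℕ) (ha : a ≠ 0) (T : Finset ι) :
    (chainsTo a T).ncard = Subdivision.chainCount a T.card := by
  have hT : T = (Finset.univ : Finset (Fin T.card)).map
      (T.equivFin.symm.toEmbedding.trans (Function.Embedding.subtype _)) := by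
    ext x
    simp only [Finset.mem_map, Finset.mem_univ, true_and]
    constructor
    · intro hx
      exact ⟨T.equivFin ⟨x, hx⟩, by simp⟩
    · rintro ⟨i, rfl⟩
      simp
  conv_lhs => rw [hT]
  rw [chainsTo_map, Set.ncard_image_of_injective _ (Finset.map_injective _),
    Subdivision.chainCount, if_neg ha]
  congr 1
  ext c
  constructor
  · rintro ⟨h1, h2, h3, h4⟩
    exact ⟨⟨⟨_, h1⟩, fun s hs => (h2 s hs).1, h3⟩, h4, h1⟩
  · rintro ⟨⟨_, h2, h3⟩, h4, h1⟩
    exact ⟨h1, fun s hs => ⟨h2 s hs, Finset.subset_univ s⟩, h3, h4⟩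

theorem finite_barycentricSubdivision {ι : Type*} (Δ : PreAbstractSimplicialComplex ι)
    (hfin : Δ.faces.Finite) : Δ.barycentricSubdivision.faces.Finite := by
  refine (Finset.finite_toSet hfin.toFinset.powerset).subset fun c hc => ?_
  simp only [Finset.mem_coe, Finset.mem_powerset]
  exact fun s hs => hfin.mem_toFinset.2 (hc.2.1 s hs)

theorem numSimplices_zero {ι : Type*} (Δ : PreAbstractSimplicialComplex ι) :
    Δ.numSimplices 0 = 1 := by
  rw [numSimplices, Set.ncard_eq_one]
  refine ⟨∅, ?_⟩
  ext s
  simp only [Finset.card_eq_zero, Set.mem_ofPred_eq, Set.mem_singleton_iff, simplices,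
    Set.mem_insert_iff]
  tauto

theorem numSimplices_eq_of_ne_zero {ι : Type*} (Δ : PreAbstractSimplicialComplex ι) {a : ℕ}
    (ha : a ≠ 0) : Δ.numSimplices a = {s : Finset ι | s ∈ Δ.faces ∧ s.card = a}.ncard := by
  rw [numSimplices]
  congr 1
  ext s
  simp only [simplices, Set.mem_ofPred_eq, Set.mem_insert_iff]
  constructor
  · rintro ⟨rfl | h, h'⟩
    · exact absurd h'.symm (by simpa using ha)
    · exact ⟨h, h'⟩
  · rintro ⟨h, h'⟩
    exact ⟨Or.inr h, h'⟩

/-- How face numbers change under barycentric subdivision. -/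
theorem numSimplices_barycentricSubdivision {ι : Type*} (Δ : PreAbstractSimplicialComplex ι)
    (hfin : Δ.faces.Finite) {n : ℕ} (hn : ∀ s ∈ Δ.faces, s.card ≤ n) (a : ℕ) :
    Δ.barycentricSubdivision.numSimplices a =
      ∑ b ∈ Finset.range (n + 1), Δ.numSimplices b * Subdivision.chainCount a b := by
  classical
  rcases eq_or_ne a 0 with rfl | ha
  · rw [numSimplices_zero, Finset.sum_range_succ']
    simp [Subdivision.chainCount, numSimplices_zero]
  -- A nonempty chain has a unique largest member, so these sets partition the chains; grouping the
  -- members `T` by cardinality then gives the formula.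
  have hunion : {c : Finset (Finset ι) | c ∈ Δ.barycentricSubdivision.faces ∧ c.card = a} =
      ⋃ T ∈ Δ.faces, chainsTo a T := by
    ext c
    simp only [Set.mem_ofPred_eq, Set.mem_iUnion, exists_prop]
    constructor
    · rintro ⟨⟨hne, hf, hc⟩, hca⟩
      obtain ⟨T, hT, hmax⟩ := exists_greatest_of_isChain hne hc
      exact ⟨T, hf T hT, hT, fun s hs => ⟨(Δ.isRelLowerSet_faces (hf s hs)).1, hmax s hs⟩,
        hc, hca⟩
    · rintro ⟨T, hT, h1, h2, h3, h4⟩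
      exact ⟨⟨⟨T, h1⟩, fun s hs => (Δ.isRelLowerSet_faces hT).2 (h2 s hs).2 (h2 s hs).1, h3⟩, h4⟩
  have hzero : Subdivision.chainCount a 0 = 0 := by
    obtain ⟨a, rfl⟩ := Nat.exists_eq_succ_of_ne_zero ha
    exact Subdivision.chainCount_succ_zero a
  rw [numSimplices_eq_of_ne_zero _ ha, hunion,
    Set.Finite.ncard_biUnion hfin (fun T _ => finite_chainsTo a T) ?_,
    finsum_mem_eq_finite_toFinset_sum _ hfin,
    Finset.sum_congr rfl fun T _ => ncard_chainsTo a ha T,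
    ← Finset.sum_fiberwise_of_maps_to (t := Finset.range (n + 1)) (g := Finset.card)]
  · refine Finset.sum_congr rfl fun b _ => ?_
    rcases eq_or_ne b 0 with rfl | hb
    · rw [hzero, mul_zero]
      refine Finset.sum_eq_zero fun T hT => ?_
      rw [(Finset.mem_filter.1 hT).2, hzero]
    · rw [Finset.sum_congr rfl (g := fun _ => Subdivision.chainCount a b)
        fun T hT => by rw [(Finset.mem_filter.1 hT).2], Finset.sum_const, smul_eq_mul,
        numSimplices_eq_of_ne_zero _ hb, ← Set.ncard_coe_finset]
      congr 3
      ext s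
      simp
  · intro T hT
    exact Finset.mem_range.2 (Nat.lt_succ_of_le (hn T (hfin.mem_toFinset.1 hT)))
  · intro T _ T' _ hTT'
    refine Set.disjoint_left.2 fun c hc hc' => hTT' ?_
    exact ((hc'.2.1 T hc.1).2).antisymm (hc.2.1 T' hc'.1).2

end PreAbstractSimplicialComplex

/-! ### Recursion and triangularity of the chain counts. -/

namespace Subdivision
open PreAbstractSimplicialComplex

/-- The boundary of the simplex with `b` vertices. -/
def simplexBoundary (b : ℕ) : PreAbstractSimplicialComplex (Fin b) where
  faces := {s | s.Nonempty ∧ s ≠ Finset.univ}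
  isRelLowerSet_faces := fun {_} hs =>
    ⟨hs.1, fun _ hts ht => ⟨ht, fun h => hs.2 (Finset.univ_subset_iff.1 (h ▸ hts))⟩⟩

theorem numSimplices_simplexBoundary {b j : ℕ} (hj : j < b) :
    (simplexBoundary b).numSimplices j = b.choose j := by
  rcases eq_or_ne j 0 with rfl | hj0
  · simp [numSimplices_zero]
  rw [numSimplices_eq_of_ne_zero _ hj0]
  have : {s : Finset (Fin b) | s ∈ (simplexBoundary b).faces ∧ s.card = j} =
      ((Finset.univ : Finset (Fin b)).powersetCard j : Finset (Finset (Fin b))) := by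
    ext s
    simp only [simplexBoundary, Set.mem_ofPred_eq, Finset.mem_coe, Finset.mem_powersetCard,
      Finset.subset_univ, true_and]
    constructor
    · exact fun h => h.2
    · intro h
      refine ⟨⟨Finset.card_pos.1 (by omega), ?_⟩, h⟩
      rintro rfl
      simp at h
      omega
  rw [this, Set.ncard_coe_finset, Finset.card_powersetCard, Finset.card_univ, Fintype.card_fin]

/-- Deleting the top element `univ` from a chain leaves a possibly empty chain of proper nonempty
subsets. For `b = 0` the set `univ` is empty and cannot belong to a chain. -/
theorem chainCount_succ_eq_numSimplices {b : ℕ} (hb : b ≠ 0) (a : ℕ) :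
    chainCount (a + 1) b = (simplexBoundary b).barycentricSubdivision.numSimplices a := by
  classical
  rw [chainCount, if_neg (Nat.succ_ne_zero a), numSimplices]
  have hne : (Finset.univ : Finset (Fin b)).Nonempty := by
    rw [Finset.univ_nonempty_iff]
    exact Fin.pos_iff_nonempty.1 (Nat.pos_of_ne_zero hb)
  have key : ∀ c ∈ (simplexBoundary b).barycentricSubdivision.simplices,
      (∀ s ∈ c, s.Nonempty ∧ s ≠ Finset.univ) ∧
        IsChain (fun s t : Finset (Fin b) => s ⊆ t) (c : Set (Finset (Fin b))) := by
    rintro c (rfl | hc)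
    · simp
    · exact ⟨hc.2.1, hc.2.2⟩
  symm
  refine Set.ncard_congr (fun c _ => insert Finset.univ c) ?_ ?_ ?_
  · rintro c ⟨hc, hca⟩
    obtain ⟨h1, h2⟩ := key c hc
    refine ⟨⟨Finset.insert_nonempty _ _, ?_, ?_⟩, ?_, Finset.mem_insert_self _ _⟩
    · intro s hs
      rcases Finset.mem_insert.1 hs with rfl | hs
      · exact hne
      · exact (h1 s hs).1
    · rw [Finset.coe_insert]
      exact h2.insert fun t _ _ => Or.inr (Finset.subset_univ t)
    · rw [Finset.card_insert_of_notMem fun h => (h1 _ h).2 rfl, hca]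
  · rintro c c' ⟨hc, -⟩ ⟨hc', -⟩ h
    have h1 : Finset.univ ∉ c := fun h => ((key c hc).1 _ h).2 rfl
    have h2 : Finset.univ ∉ c' := fun h => ((key c' hc').1 _ h).2 rfl
    rw [← Finset.erase_insert h1, ← Finset.erase_insert h2]
    exact congrArg (Finset.erase · Finset.univ) h
  · rintro c ⟨⟨-, h1, h2⟩, hca, hu⟩
    refine ⟨c.erase Finset.univ, ⟨?_, ?_⟩, Finset.insert_erase hu⟩
    · rcases (c.erase Finset.univ).eq_empty_or_nonempty with h | h
      · exact Or.inl h
      · refine Or.inr ⟨h, fun s hs => ⟨h1 s (Finset.mem_of_mem_erase hs),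
          Finset.ne_of_mem_erase hs⟩, h2.mono ?_⟩
        exact Finset.coe_subset.2 (Finset.erase_subset _ _)
    · rw [Finset.card_erase_of_mem hu, hca, Nat.add_sub_cancel]

/-- The subdivision formula applied to the boundary of a simplex, whose face numbers are binomial
coefficients. -/
theorem chainCount_succ (a b : ℕ) :
    chainCount (a + 1) b = ∑ j ∈ Finset.range b, b.choose j * chainCount a j := by
  rcases b with _ | b
  · simp [chainCount_succ_zero]
  rw [chainCount_succ_eq_numSimplices (Nat.succ_ne_zero b),
    numSimplices_barycentricSubdivision _ (Set.toFinite _) (n := b)]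
  · exact Finset.sum_congr rfl fun j hj => by
      rw [numSimplices_simplexBoundary (Finset.mem_range.1 hj)]
  · rintro s ⟨-, hs⟩
    have := Finset.card_lt_univ_of_notMem (s := s)
      (x := (not_forall.1 (mt Finset.eq_univ_iff_forall.2 hs)).choose)
      (not_forall.1 (mt Finset.eq_univ_iff_forall.2 hs)).choose_spec
    rw [Fintype.card_fin] at this
    omega

theorem chainCount_eq_zero_of_lt {a b : ℕ} (h : b < a) : chainCount a b = 0 := by
  induction a generalizing b with
  | zero => omega
  | succ a ih =>
    rw [chainCount_succ]
    refine Finset.sum_eq_zero fun j hj => ?_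
    rw [ih (by have := Finset.mem_range.1 hj; omega), mul_zero]

theorem chainCount_self (a : ℕ) : chainCount a a = a.factorial := by
  induction a with
  | zero => simp [chainCount_zero_left]
  | succ a ih =>
    rw [chainCount_succ, Finset.sum_range_succ, ih, Nat.choose_succ_self_right,
      Finset.sum_eq_zero, zero_add, Nat.factorial_succ]
    intro j hj
    rw [chainCount_eq_zero_of_lt (Finset.mem_range.1 hj), mul_zero]

theorem chainCount_one_succ (b : ℕ) : chainCount 1 (b + 1) = 1 := by
  rw [chainCount_succ, Finset.sum_range_succ']
  simp [chainCount_zero_left]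

end Subdivision

/-! ### Dimension and face numbers along iterated subdivision. -/

namespace PreAbstractSimplicialComplex

theorem maxCard_eq_iff {ι : Type*} (Δ : PreAbstractSimplicialComplex ι)
    (hfin : Δ.faces.Finite) {n : ℕ} (hn : n ≠ 0) :
    Δ.maxCard = n ↔ (∀ s ∈ Δ.faces, s.card ≤ n) ∧ Δ.numSimplices n ≠ 0 := by
  have hsfin : Δ.simplices.Finite := hfin.insert _
  have hbdd : BddAbove (Finset.card '' Δ.simplices) := (hsfin.image _).bddAbove
  have hne : (Finset.card '' Δ.simplices).Nonempty := ⟨0, ∅, Or.inl rfl, rfl⟩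
  have hnum : Δ.numSimplices n ≠ 0 ↔ ∃ s ∈ Δ.faces, s.card = n := by
    rw [numSimplices_eq_of_ne_zero _ hn, ← Nat.pos_iff_ne_zero,
      Set.ncard_pos (hfin.subset fun s hs => hs.1)]
    rfl
  rw [hnum]
  constructor
  · rintro rfl
    refine ⟨fun s hs => le_csSup hbdd ⟨s, Or.inr hs, rfl⟩, ?_⟩
    obtain ⟨s, hs, h⟩ := Nat.sSup_mem hne hbdd
    rcases hs with rfl | hs
    · exact absurd (h.symm.trans Finset.card_empty) hn
    · exact ⟨s, hs, h⟩
  · rintro ⟨h1, s, hs, h2⟩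
    refine le_antisymm (csSup_le hne ?_) (h2 ▸ le_csSup hbdd ⟨s, Or.inr hs, rfl⟩)
    rintro _ ⟨t, rfl | ht, rfl⟩
    · simp
    · exact h1 t ht

/-- Triangularity of `chainCount` excludes larger simplices, and the diagonal entry `n!` keeps the
number of top-dimensional ones nonzero. -/
theorem maxCard_barycentricSubdivision {ι : Type*} (Δ : PreAbstractSimplicialComplex ι)
    (hfin : Δ.faces.Finite) {n : ℕ} (hn : n ≠ 0) (h : Δ.maxCard = n) :
    Δ.barycentricSubdivision.maxCard = n := by
  have hfin' := Δ.finite_barycentricSubdivision hfin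
  obtain ⟨h1, h2⟩ := (Δ.maxCard_eq_iff hfin hn).1 h
  refine (maxCard_eq_iff _ hfin' hn).2 ⟨?_, ?_⟩
  · intro c hc
    by_contra hlt
    rw [not_le] at hlt
    have h0 := Δ.numSimplices_barycentricSubdivision hfin h1 c.card
    rw [Finset.sum_eq_zero, numSimplices_eq_of_ne_zero _ (by omega),
      Set.ncard_eq_zero (hfin'.subset fun s hs => hs.1)] at h0
    · exact Set.eq_empty_iff_forall_notMem.1 h0 c ⟨hc, rfl⟩
    · intro b hb
      rw [Subdivision.chainCount_eq_zero_of_lt (by have := Finset.mem_range.1 hb; omega), mul_zero]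
  · rw [Δ.numSimplices_barycentricSubdivision hfin h1, Finset.sum_range_succ,
      Subdivision.chainCount_self]
    have := Nat.mul_pos (Nat.pos_of_ne_zero h2) n.factorial_pos
    omega

theorem iterSubdivision_finite {ι : Type*} (Δ : PreAbstractSimplicialComplex ι)
    (hfin : Δ.faces.Finite) (k : ℕ) : (Δ.iterSubdivision k).faces.Finite := by
  induction k with
  | zero => exact hfin
  | succ k ih => exact finite_barycentricSubdivision _ ih

theorem maxCard_iterSubdivision {ι : Type*} (Δ : PreAbstractSimplicialComplex ι)
    (hfin : Δ.faces.Finite) {n : ℕ} (hn : n ≠ 0) (h : Δ.maxCard = n) (k : ℕ) :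
    (Δ.iterSubdivision k).maxCard = n := by
  induction k with
  | zero => exact h
  | succ k ih => exact maxCard_barycentricSubdivision _ (Δ.iterSubdivision_finite hfin k) hn ih

theorem numSimplices_iterSubdivision_succ {ι : Type*} (Δ : PreAbstractSimplicialComplex ι)
    (hfin : Δ.faces.Finite) {n : ℕ} (hn : n ≠ 0) (h : Δ.maxCard = n) (k a : ℕ) :
    (Δ.iterSubdivision (k + 1)).numSimplices a = ∑ b ∈ Finset.range (n + 1),
      (Δ.iterSubdivision k).numSimplices b * Subdivision.chainCount a b :=
  numSimplices_barycentricSubdivision _ (Δ.iterSubdivision_finite hfin k)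
    ((maxCard_eq_iff _ (Δ.iterSubdivision_finite hfin k) hn).1
      (Δ.maxCard_iterSubdivision hfin hn h k)).1 a

end PreAbstractSimplicialComplex

/-! ### The numbers `FNum` as an eigenvector. -/

namespace Subdivision

/-- The weight of the step `i → j` in the sums defining `FNum`. -/
noncomputable def stepWeight (n i j : ℕ) : ℚ :=
  (chainCount i j : ℚ) / ((n.factorial : ℚ) - (i.factorial : ℚ))

open scoped Classical in
/-- The weighted number of strictly increasing sequences with `m` steps from `a` to `n`. -/
noncomputable def pathSum (n m a : ℕ) : ℚ :=
  ∑ s : Fin (m + 1) → Fin (n + 1),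
    if StrictMono s ∧ (s 0 : ℕ) = a ∧ (s (Fin.last m) : ℕ) = n then
      ∏ j : Fin m, stepWeight n (s j.castSucc) (s j.succ)
    else 0

theorem pathSum_zero (n a : ℕ) : pathSum n 0 a = if a = n then 1 else 0 := by
  classical
  rw [pathSum, ← (Equiv.funUnique (Fin 1) (Fin (n + 1))).symm.sum_comp]
  have hmono : ∀ x : Fin (n + 1), StrictMono ((Equiv.funUnique (Fin 1) (Fin (n + 1))).symm x) :=
    fun x => Subsingleton.strictMono _
  simp only [hmono, true_and, Finset.univ_eq_empty, Finset.prod_empty]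
  rw [Finset.sum_eq_single (Fin.last n)]
  · simp [eq_comm]
  · intro x _ hx
    rw [if_neg]
    rintro ⟨-, h⟩
    exact hx (Fin.ext h)
  · simp

theorem strictMono_cons_iff {n m : ℕ} (x : Fin (n + 1)) (s : Fin (m + 1) → Fin (n + 1)) :
    StrictMono (Fin.cons x s : Fin (m + 2) → Fin (n + 1)) ↔ x < s 0 ∧ StrictMono s := by
  constructor
  · intro h
    refine ⟨by simpa using h (show (0 : Fin (m + 2)) < (0 : Fin (m + 1)).succ by simp), ?_⟩
    intro i j hij
    simpa using h (Fin.succ_lt_succ_iff.2 hij)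
  · rintro ⟨h0, h⟩ i j hij
    induction j using Fin.cases with
    | zero => exact absurd hij (Fin.not_lt_zero i)
    | succ j =>
      induction i using Fin.cases with
      | zero => simpa using h0.trans_le (h.monotone (Fin.zero_le j))
      | succ i => simpa using h (Fin.succ_lt_succ_iff.1 hij)

/-- Split off the first step of the path, from `a` to its second vertex `c`. -/
theorem pathSum_succ (n m a : ℕ) (ha : a ≤ n) :
    pathSum n (m + 1) a =
      ∑ c ∈ Finset.Ioc a n, stepWeight n a c * pathSum n m c := by
  classical
  have hcons : pathSum n (m + 1) a = ∑ s : Fin (m + 1) → Fin (n + 1),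
      if a < (s 0 : ℕ) ∧ StrictMono s ∧ (s (Fin.last m) : ℕ) = n then
        stepWeight n a (s 0) * ∏ j : Fin m, stepWeight n (s j.castSucc) (s j.succ) else 0 := by
    rw [pathSum, ← (Fin.consEquiv fun _ => Fin (n + 1)).sum_comp, Fintype.sum_prod_type,
      Finset.sum_eq_single (⟨a, Nat.lt_succ_of_le ha⟩ : Fin (n + 1))]
    · refine Finset.sum_congr rfl fun s _ => ?_
      have hc : (Fin.consEquiv fun _ => Fin (n + 1)) (⟨a, Nat.lt_succ_of_le ha⟩, s) =
        (Fin.cons ⟨a, Nat.lt_succ_of_le ha⟩ s : Fin (m + 2) → Fin (n + 1)) := rfl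
      simp only [hc, strictMono_cons_iff, Fin.cons_zero, ← Fin.succ_last,
        Fin.cons_succ, Fin.prod_univ_succ, Fin.castSucc_zero, ← Fin.succ_castSucc, true_and,
        Fin.lt_def, and_assoc]
    · intro x _ hx
      refine Finset.sum_eq_zero fun s _ => if_neg ?_
      rintro ⟨-, h, -⟩
      exact hx (Fin.ext (by simpa using h))
    · simp
  rw [hcons]
  simp only [pathSum, Finset.mul_sum]
  rw [Finset.sum_comm]
  refine Finset.sum_congr rfl fun s _ => ?_
  by_cases hs : a < (s 0 : ℕ)
  · rw [Finset.sum_eq_single (s 0 : ℕ)]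
    · by_cases h : StrictMono s ∧ (s (Fin.last m) : ℕ) = n
      · simp [h, hs]
      · rw [if_neg (fun h' => h h'.2), if_neg (fun h' => h ⟨h'.1, h'.2.2⟩), mul_zero]
    · intro c _ hc
      rw [if_neg (fun h' => hc h'.2.1.symm), mul_zero]
    · intro h
      exact absurd (Finset.mem_Ioc.2 ⟨hs, by omega⟩) h
  · rw [if_neg (fun h' => hs h'.1), Finset.sum_eq_zero]
    intro c hc
    rw [if_neg, mul_zero]
    rintro ⟨-, h, -⟩
    have := (Finset.mem_Ioc.1 hc).1
    omega

theorem pathSum_eq_zero {n m a : ℕ} (ha : a ≤ n) (h : n < m + a) : pathSum n m a = 0 := by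
  induction m generalizing a with
  | zero => omega
  | succ m ih =>
    rw [pathSum_succ n m a ha]
    refine Finset.sum_eq_zero fun c hc => ?_
    have := Finset.mem_Ioc.1 hc
    rw [ih this.2 (by omega), mul_zero]

theorem FNum_self (n : ℕ) : FNum n n = 1 := by simp [FNum]

theorem FNum_zero {n : ℕ} (hn : n ≠ 0) : FNum 0 n = 0 := by simp [FNum, hn.symm]

/-- Admitting the path with no step absorbs the separate case `a = n`, so a single formula feeds the
recursion `FNum_eq_sum`. -/
theorem FNum_eq_sum_pathSum {n a : ℕ} (ha0 : a ≠ 0) (ha : a ≤ n) :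
    FNum a n = ∑ m ∈ Finset.range n, pathSum n m a := by
  classical
  rcases eq_or_ne a n with rfl | hne
  · obtain ⟨a, rfl⟩ := Nat.exists_eq_succ_of_ne_zero ha0
    rw [FNum_self, Finset.sum_range_succ', pathSum_zero, Finset.sum_eq_zero]
    · simp
    · intro m _
      exact pathSum_eq_zero le_rfl (by omega)
  · have h1 : FNum a n = ∑ m ∈ Finset.range n, pathSum n (m + 1) a := by
      rw [FNum, if_neg hne, if_neg ha0]
      rfl
    have h2 := Finset.sum_range_succ' (fun m => pathSum n m a) n
    rw [Finset.sum_range_succ, pathSum_eq_zero ha (by omega), pathSum_zero, if_neg hne] at h2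
    rw [h1]
    linarith

theorem FNum_eq_sum {n a : ℕ} (ha0 : a ≠ 0) (ha : a < n) :
    FNum a n = ∑ c ∈ Finset.Ioc a n, stepWeight n a c * FNum c n := by
  have h2 := Finset.sum_range_succ' (fun m => pathSum n m a) n
  rw [Finset.sum_range_succ, pathSum_eq_zero ha.le (by omega), pathSum_zero, if_neg ha.ne,
    add_zero, add_zero, ← FNum_eq_sum_pathSum ha0 ha.le] at h2
  rw [h2, Finset.sum_congr rfl fun m _ => pathSum_succ n m a ha.le, Finset.sum_comm]
  refine Finset.sum_congr rfl fun c hc => ?_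
  have := Finset.mem_Ioc.1 hc
  rw [FNum_eq_sum_pathSum (by omega) this.2, Finset.mul_sum]

/-- The bound `2 ≤ n` is needed because `0! = 1!`. -/
theorem factorial_lt_of_lt {a n : ℕ} (hn : 2 ≤ n) (ha : a < n) : a.factorial < n.factorial := by
  rcases Nat.eq_zero_or_pos a with rfl | h0
  · exact (Nat.one_lt_factorial).2 hn
  · exact (Nat.factorial_lt h0).2 ha

/-- The numbers `FNum a n` form an eigenvector of `chainCount` for the eigenvalue `n!`. -/
theorem factorial_sub_mul_FNum {n a : ℕ} (hn : 2 ≤ n) (ha : a < n) :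
    ((n.factorial : ℚ) - a.factorial) * FNum a n =
      ∑ c ∈ Finset.Ioc a n, (chainCount a c : ℚ) * FNum c n := by
  have hpos : ((n.factorial : ℚ) - a.factorial) ≠ 0 := by
    have : (a.factorial : ℚ) < n.factorial := by exact_mod_cast factorial_lt_of_lt hn ha
    linarith
  rcases eq_or_ne a 0 with rfl | ha0
  · rw [FNum_zero (by omega), mul_zero, Finset.sum_eq_zero]
    intro c hc
    have := Finset.mem_Ioc.1 hc
    rw [chainCount_zero_left, if_neg (by omega), Nat.cast_zero, zero_mul]
  · rw [FNum_eq_sum ha0 ha, Finset.mul_sum]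
    refine Finset.sum_congr rfl fun c _ => ?_
    rw [stepWeight]
    field_simp

theorem sum_chainCount_mul_eq {R : Type*} [CommRing R] {n a : ℕ} (ha : a ≤ n) (u : ℕ → R) :
    ∑ b ∈ Finset.range (n + 1), (chainCount a b : R) * u b =
      a.factorial * u a + ∑ c ∈ Finset.Ioc a n, (chainCount a c : R) * u c := by
  rw [← chainCount_self a, Finset.range_eq_Ico, ← Finset.sum_Ico_consecutive _ (Nat.zero_le a)
    (by omega : a ≤ n + 1), Finset.sum_eq_zero, zero_add, Finset.sum_eq_sum_Ico_succ_bot (by omega)]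
  · congr 2
    ext c
    simp only [Finset.mem_Ico, Finset.mem_Ioc]
    omega
  · intro b hb
    rw [chainCount_eq_zero_of_lt (Finset.mem_Ico.1 hb).2, Nat.cast_zero, zero_mul]

theorem sum_chainCount_mul_FNum {n a : ℕ} (hn : 2 ≤ n) (ha : a ≤ n) :
    ∑ b ∈ Finset.range (n + 1), (chainCount a b : ℚ) * FNum b n =
      n.factorial * FNum a n := by
  rw [sum_chainCount_mul_eq ha]
  rcases ha.eq_or_lt with rfl | ha
  · simp
  · rw [← factorial_sub_mul_FNum hn ha]
    ring

theorem FNum_nonneg {n : ℕ} (hn : 2 ≤ n) {a : ℕ} (ha : a ≤ n) : 0 ≤ FNum a n := by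
  induction h : n - a using Nat.strong_induction_on generalizing a with
  | _ m ih =>
    rcases ha.eq_or_lt with rfl | hlt
    · rw [FNum_self]
      exact zero_le_one
    · have hpos : (0 : ℚ) < (n.factorial : ℚ) - a.factorial := by
        have : (a.factorial : ℚ) < n.factorial := by exact_mod_cast factorial_lt_of_lt hn hlt
        linarith
      refine nonneg_of_mul_nonneg_right ?_ hpos
      rw [factorial_sub_mul_FNum hn hlt]
      refine Finset.sum_nonneg fun c hc => mul_nonneg (Nat.cast_nonneg _) ?_
      have := Finset.mem_Ioc.1 hc
      exact ih (n - c) (by omega) this.2 rfl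

/-- In the eigenvector equation all terms are nonnegative and the term `c = n` equals 1. -/
theorem FNum_one_pos {n : ℕ} (hn : 2 ≤ n) : 0 < FNum 1 n := by
  have hpos : (0 : ℚ) < (n.factorial : ℚ) - (1 : ℕ).factorial := by
    have : ((1 : ℕ).factorial : ℚ) < n.factorial := by
      exact_mod_cast factorial_lt_of_lt hn (by omega : 1 < n)
    linarith
  refine pos_of_mul_pos_right ?_ hpos.le
  rw [factorial_sub_mul_FNum hn (by omega)]
  refine Finset.sum_pos' (fun c hc => mul_nonneg (Nat.cast_nonneg _)
    (FNum_nonneg hn (Finset.mem_Ioc.1 hc).2)) ⟨n, Finset.mem_Ioc.2 ⟨by omega, le_rfl⟩, ?_⟩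
  obtain ⟨b, rfl⟩ := Nat.exists_eq_succ_of_ne_zero (by omega : n ≠ 0)
  rw [chainCount_one_succ, FNum_self]
  norm_num

end Subdivision

/-! ### Dehn–Sommerville symmetry of the limiting face numbers. -/

namespace Subdivision

/-- The generating polynomial `∑ a, chainCount a b * X ^ a`. -/
noncomputable def chainPoly (b : ℕ) : ℚ[X] :=
  ∑ a ∈ Finset.range (b + 1), C (chainCount a b : ℚ) * X ^ a

theorem coeff_chainPoly (a b : ℕ) : (chainPoly b).coeff a = chainCount a b := by
  simp only [chainPoly, finsetSum_coeff, coeff_C_mul, coeff_X_pow, mul_ite, mul_one, mul_zero,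
    Finset.sum_ite_eq, Finset.mem_range]
  split_ifs with h
  · rfl
  · rw [chainCount_eq_zero_of_lt (by omega), Nat.cast_zero]

/-- The action of the barycentric subdivision on generating polynomials of face numbers. -/
noncomputable def subdivisionMap : ℚ[X] →ₗ[ℚ] ℚ[X] :=
  (Polynomial.basisMonomials ℚ).constr ℚ chainPoly

theorem subdivisionMap_X_pow (b : ℕ) : subdivisionMap (X ^ b) = chainPoly b := by
  have := (Polynomial.basisMonomials ℚ).constr_basis ℚ chainPoly b
  rwa [Polynomial.coe_basisMonomials, show (fun s => monomial s (1 : ℚ)) b = X ^ b from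
    monomial_one_right_eq_X_pow b] at this

theorem subdivisionMap_eq_sum {p : ℚ[X]} {n : ℕ} (hp : p.natDegree ≤ n) :
    subdivisionMap p = ∑ b ∈ Finset.range (n + 1), p.coeff b • chainPoly b := by
  conv_lhs => rw [p.as_sum_range' (n + 1) (by omega)]
  rw [map_sum]
  refine Finset.sum_congr rfl fun b _ => ?_
  rw [← smul_X_eq_monomial, map_smul, subdivisionMap_X_pow]

theorem coeff_subdivisionMap {p : ℚ[X]} {n : ℕ} (hp : p.natDegree ≤ n) (a : ℕ) :
    (subdivisionMap p).coeff a =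
      ∑ b ∈ Finset.range (n + 1), (chainCount a b : ℚ) * p.coeff b := by
  rw [subdivisionMap_eq_sum hp, finsetSum_coeff]
  refine Finset.sum_congr rfl fun b _ => ?_
  rw [coeff_smul, coeff_chainPoly, smul_eq_mul, mul_comm]

/-- The recursion `chainCount_succ` in generating-function form; the constant corrects the empty
chain at `b = 0`. -/
theorem X_mul_sum_choose_chainPoly (b : ℕ) :
    X * ∑ j ∈ Finset.range b, (b.choose j : ℚ) • chainPoly j =
      chainPoly b - C (if b = 0 then 1 else 0) := by
  ext a
  rcases a with _ | a
  · rw [mul_coeff_zero, coeff_X_zero, zero_mul, coeff_sub, coeff_C_zero, coeff_chainPoly,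
      chainCount_zero_left]
    push_cast
    ring
  · rw [coeff_X_mul, finsetSum_coeff, coeff_sub, coeff_C_succ, sub_zero, coeff_chainPoly,
      chainCount_succ]
    push_cast
    refine Finset.sum_congr rfl fun j _ => ?_
    rw [coeff_smul, coeff_chainPoly, smul_eq_mul]

theorem X_add_one_pow_eq (b : ℕ) : (X + 1 : ℚ[X]) ^ b =
    ∑ j ∈ Finset.range b, (b.choose j : ℚ) • X ^ j + X ^ b := by
  rw [add_pow, Finset.sum_range_succ]
  simp only [one_pow, mul_one, Nat.choose_self, Nat.cast_one, add_left_inj]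
  refine Finset.sum_congr rfl fun j _ => ?_
  rw [smul_eq_C_mul, mul_comm, C_eq_natCast]

/-- On `X ^ b`, expanding `(X + 1) ^ b` produces the proper-subset sum of `chainCount_succ` plus the
top term `X ^ b`. -/
theorem subdivisionMap_functional_eq (p : ℚ[X]) :
    (1 + X) * subdivisionMap p = X * subdivisionMap (p.comp (X + 1)) + C (p.eval 0) := by
  induction p using Polynomial.induction_on' with
  | add p q hp hq =>
    rw [map_add, mul_add, hp, hq, add_comp, map_add, eval_add, C_add]
    ring
  | monomial b c =>
    rw [← smul_X_eq_monomial, map_smul, smul_comp, map_smul, eval_smul, X_pow_comp,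
      X_add_one_pow_eq, map_add, map_sum]
    simp only [map_smul, subdivisionMap_X_pow]
    rw [mul_smul_comm, mul_smul_comm, mul_add, X_mul_sum_choose_chainPoly, eval_pow, eval_X,
      zero_pow_eq, smul_eq_mul, C_mul, ← smul_eq_C_mul, ← smul_add]
    congr 1
    ring

/-- By induction on `b`, the lower terms of `(X + 1) ^ b` contribute nothing, leaving `(1 + X) * E
(X ^ b) = X * E (X ^ b)`. -/
theorem eq_zero_of_functional_eq (E : ℚ[X] →ₗ[ℚ] ℚ[X])
    (hE : ∀ p, (1 + X) * E p = X * E (p.comp (X + 1))) : E = 0 := by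
  have hpow : ∀ b, E (X ^ b) = 0 := by
    intro b
    induction b using Nat.strong_induction_on with
    | _ b ih =>
      have h := hE (X ^ b)
      rw [X_pow_comp, X_add_one_pow_eq, map_add, map_sum, Finset.sum_eq_zero, zero_add] at h
      · linear_combination h
      · intro j hj
        rw [map_smul, ih j (Finset.mem_range.1 hj), smul_zero]
  refine LinearMap.ext fun p => ?_
  rw [LinearMap.zero_apply, p.as_sum_range, map_sum]
  refine Finset.sum_eq_zero fun b _ => ?_
  rw [← smul_X_eq_monomial, map_smul, hpow, smul_zero]

/-- The substitution `X ↦ -1 - X`. -/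
noncomputable def reflect : ℚ[X] →ₗ[ℚ] ℚ[X] :=
  (Polynomial.aeval (-1 - X : ℚ[X])).toLinearMap

theorem reflect_apply (p : ℚ[X]) : reflect p = p.comp (-1 - X) := rfl

theorem reflect_reflect (p : ℚ[X]) : reflect (reflect p) = p := by
  rw [reflect_apply, reflect_apply, comp_assoc]
  simp

theorem reflect_mul (p q : ℚ[X]) : reflect (p * q) = reflect p * reflect q := mul_comp _ _ _

/-- The reflection `X ↦ -1 - X`, which encodes the Dehn–Sommerville relations, commutes with
the action of the barycentric subdivision. -/
theorem subdivisionMap_reflect (p : ℚ[X]) :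
    subdivisionMap (reflect p) = reflect (subdivisionMap p) := by
  -- The functional equation at `p`, and the reflection of the one at `p(-X)`, have the same
  -- constant term; their difference is the homogeneous equation.
  have hE : subdivisionMap - reflect ∘ₗ subdivisionMap ∘ₗ reflect = 0 := by
    refine eq_zero_of_functional_eq _ fun p => ?_
    have h1 := subdivisionMap_functional_eq p
    have h2 := congrArg reflect (subdivisionMap_functional_eq (reflect (p.comp (X + 1))))
    have h3 : (reflect (p.comp (X + 1))).comp (X + 1) = reflect p := by
      rw [reflect_apply, reflect_apply, comp_assoc, comp_assoc]
      congr 1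
      simp
      ring
    have h4 : (reflect (p.comp (X + 1))).eval 0 = p.eval 0 := by
      simp [reflect_apply, eval_comp]
    have h5 : reflect (1 + X) = -X := by
      simp only [reflect_apply, add_comp, one_comp, X_comp]
      ring
    have h6 : reflect X = -1 - X := by simp [reflect_apply]
    have h7 : ∀ c, reflect (C c) = C c := fun c => by simp [reflect_apply]
    rw [h3, h4, map_add, reflect_mul, reflect_mul, h5, h6, h7] at h2
    simp only [LinearMap.sub_apply, LinearMap.comp_apply]
    linear_combination h1 - h2
  have := congrArg reflect (LinearMap.congr_fun hE p)
  simp only [LinearMap.sub_apply, LinearMap.comp_apply, LinearMap.zero_apply, map_sub,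
    reflect_reflect, map_zero] at this
  exact (sub_eq_zero.1 this).symm

/-- By triangularity the operator multiplies the top coefficient by `(deg g)!`, which differs from
`n!`. -/
theorem eq_zero_of_subdivisionMap_eq_smul {n : ℕ} (hn : 2 ≤ n) {g : ℚ[X]}
    (hg : subdivisionMap g = (n.factorial : ℚ) • g) (hdeg : g.natDegree < n) : g = 0 := by
  have h := congrArg (fun p => p.coeff g.natDegree) hg
  simp only [coeff_smul, smul_eq_mul, coeff_subdivisionMap le_rfl,
    sum_chainCount_mul_eq le_rfl, Finset.Ioc_self, Finset.sum_empty, add_zero] at h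
  have hlt : (g.natDegree.factorial : ℚ) < n.factorial := by
    exact_mod_cast factorial_lt_of_lt hn hdeg
  have : ((n.factorial : ℚ) - g.natDegree.factorial) * g.coeff g.natDegree = 0 := by
    linear_combination -h
  rcases mul_eq_zero.1 this with h | h
  · linarith
  · exact leadingCoeff_eq_zero.1 h

/-- The generating polynomial of the limiting face numbers. -/
noncomputable def limitPoly (n : ℕ) : ℚ[X] :=
  ∑ a ∈ Finset.range (n + 1), C (FNum a n) * X ^ a

theorem coeff_limitPoly {n a : ℕ} (ha : a ≤ n) : (limitPoly n).coeff a = FNum a n := by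
  simp only [limitPoly, finsetSum_coeff, coeff_C_mul, coeff_X_pow, mul_ite, mul_one, mul_zero,
    Finset.sum_ite_eq, Finset.mem_range, if_pos (Nat.lt_succ_of_le ha)]

theorem natDegree_limitPoly (n : ℕ) : (limitPoly n).natDegree = n := by
  refine natDegree_eq_of_le_of_coeff_ne_zero ?_ ?_
  · exact natDegree_sum_le_of_forall_le _ _ fun a ha =>
      (natDegree_C_mul_X_pow_le _ _).trans (Nat.lt_succ_iff.1 (Finset.mem_range.1 ha))
  · rw [coeff_limitPoly le_rfl, FNum_self]
    exact one_ne_zero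

theorem subdivisionMap_limitPoly {n : ℕ} (hn : 2 ≤ n) :
    subdivisionMap (limitPoly n) = (n.factorial : ℚ) • limitPoly n := by
  ext a
  rw [coeff_subdivisionMap (natDegree_limitPoly n).le, coeff_smul, smul_eq_mul]
  have hcongr : ∑ b ∈ Finset.range (n + 1), (chainCount a b : ℚ) * (limitPoly n).coeff b =
      ∑ b ∈ Finset.range (n + 1), (chainCount a b : ℚ) * FNum b n :=
    Finset.sum_congr rfl fun b hb => by
      rw [coeff_limitPoly (Nat.lt_succ_iff.1 (Finset.mem_range.1 hb))]
  rw [hcongr]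
  rcases le_or_gt a n with ha | ha
  · rw [coeff_limitPoly ha, sum_chainCount_mul_FNum hn ha]
  · rw [coeff_eq_zero_of_natDegree_lt (by rwa [natDegree_limitPoly]), mul_zero,
      Finset.sum_eq_zero]
    intro b hb
    rw [chainCount_eq_zero_of_lt (by have := Finset.mem_range.1 hb; omega), Nat.cast_zero, zero_mul]

/-- The Dehn–Sommerville relations for the limiting face numbers. -/
theorem limitPoly_comp {n : ℕ} (hn : 2 ≤ n) :
    (limitPoly n).comp (-1 - X) = (-1) ^ n * limitPoly n := by
  have hdeg1 : (-1 - X : ℚ[X]).natDegree = 1 := by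
    rw [show (-1 - X : ℚ[X]) = C (-1) * X + C (-1) by simp; ring]
    exact natDegree_linear (by norm_num)
  have hlead : (-1 - X : ℚ[X]).leadingCoeff = -1 := by
    rw [leadingCoeff, hdeg1, coeff_sub, coeff_X_one]
    simp [coeff_one]
  have hnat : (reflect (limitPoly n)).natDegree = n := by
    rw [reflect_apply, natDegree_comp, hdeg1, natDegree_limitPoly, mul_one]
  rw [← reflect_apply, ← sub_eq_zero]
  have hC : ((-1) ^ n * limitPoly n : ℚ[X]) = ((-1) ^ n : ℚ) • limitPoly n := by
    rw [smul_eq_C_mul]; simp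
  rw [hC]
  refine eq_zero_of_subdivisionMap_eq_smul hn ?_ ?_
  · rw [map_sub, subdivisionMap_reflect, map_smul, subdivisionMap_limitPoly hn, map_smul,
      smul_sub, smul_comm]
  -- Both terms have the same coefficient in degree `n`, so the difference is an eigenvector of
  -- smaller degree.
  · have hle : (reflect (limitPoly n) - ((-1) ^ n : ℚ) • limitPoly n).natDegree ≤ n :=
      (natDegree_sub_le _ _).trans (max_le hnat.le
        ((natDegree_smul_le _ _).trans (natDegree_limitPoly n).le))
    refine lt_of_le_of_ne hle fun heq => ?_
    have hcoeff : (reflect (limitPoly n) - ((-1) ^ n : ℚ) • limitPoly n).coeff n = 0 := by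
      have h := coeff_comp_degree_mul_degree (p := limitPoly n) (q := -1 - X) (by rw [hdeg1]; simp)
      rw [hdeg1, hlead, natDegree_limitPoly, mul_one, leadingCoeff, natDegree_limitPoly,
        coeff_limitPoly le_rfl, FNum_self, one_mul] at h
      rw [coeff_sub, reflect_apply, h, coeff_smul, coeff_limitPoly le_rfl, FNum_self]
      simp
    have hzero : reflect (limitPoly n) - ((-1) ^ n : ℚ) • limitPoly n = 0 := by
      rw [← leadingCoeff_eq_zero, leadingCoeff, heq, hcoeff]
    rw [hzero, natDegree_zero] at heq
    omega

theorem eval_limitPoly_zero {n : ℕ} (hn : 2 ≤ n) : (limitPoly n).eval 0 = 0 := by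
  rw [← coeff_zero_eq_eval_zero, coeff_limitPoly (Nat.zero_le n), FNum_zero (by omega)]

theorem eval_limitPoly_neg_one {n : ℕ} (hn : 2 ≤ n) : (limitPoly n).eval (-1) = 0 := by
  have h := congrArg (eval 0) (limitPoly_comp hn)
  rw [eval_comp, eval_mul, eval_limitPoly_zero hn] at h
  simpa using h

theorem eval_derivative_limitPoly {n : ℕ} (hn : 2 ≤ n) :
    (derivative (limitPoly n)).eval (-1) = -(-1) ^ n * FNum 1 n := by
  have h := congrArg (fun p => (derivative p).eval 0) (limitPoly_comp hn)
  have hC : ((-1) ^ n * limitPoly n : ℚ[X]) = C ((-1) ^ n : ℚ) * limitPoly n := by simp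
  have h1 : (derivative (limitPoly n)).eval 0 = FNum 1 n := by
    rw [← coeff_zero_eq_eval_zero, coeff_derivative, coeff_limitPoly (by omega)]
    simp
  simp only [hC, derivative_comp, derivative_C_mul, eval_mul, eval_C, eval_comp, h1] at h
  simp only [map_sub, derivative_X, eval_sub, eval_one, eval_neg, eval_X, sub_zero,
    derivative_neg, derivative_one, neg_zero, zero_sub] at h
  linear_combination -h

/-! ### Extreme coefficients of the `H`-polynomial. -/

theorem HPoly_eq_sum (d : ℕ) : HPoly d =
    ∑ a ∈ Finset.range (d + 2), C (FNum a (d + 1)) * (X - 1) ^ (d + 1 - a) := by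
  rw [HPoly, FPoly, ← coe_compRingHom_apply, map_sum]
  simp

theorem coeff_X_sub_one_pow_self (m : ℕ) : ((X - 1 : ℚ[X]) ^ m).coeff m = 1 := by
  have h : (X - 1 : ℚ[X]) = X - C 1 := by simp
  have := ((monic_X_sub_C (1 : ℚ)).pow m).coeff_natDegree
  rwa [natDegree_pow, natDegree_X_sub_C, mul_one, ← h] at this

theorem natDegree_X_sub_one_pow (m : ℕ) : ((X - 1 : ℚ[X]) ^ m).natDegree = m := by
  have h : (X - 1 : ℚ[X]) = X - C 1 := by simp
  rw [h, natDegree_pow, natDegree_X_sub_C, mul_one]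

theorem natDegree_HPoly_le {d : ℕ} : (HPoly d).natDegree ≤ d := by
  rw [HPoly_eq_sum, Finset.sum_range_succ', FNum_zero (Nat.succ_ne_zero d), C_0, zero_mul, add_zero]
  refine natDegree_sum_le_of_forall_le _ _ fun a _ => ?_
  refine (natDegree_C_mul_le _ _).trans ?_
  rw [natDegree_X_sub_one_pow]
  omega

theorem coeff_HPoly_self (d : ℕ) : (HPoly d).coeff d = FNum 1 (d + 1) := by
  rw [HPoly_eq_sum, Finset.sum_range_succ', FNum_zero (Nat.succ_ne_zero d), C_0, zero_mul, add_zero,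
    Finset.sum_range_succ', coeff_add, finsetSum_coeff, Finset.sum_eq_zero, zero_add, coeff_C_mul,
    zero_add, Nat.add_sub_cancel, coeff_X_sub_one_pow_self, mul_one]
  intro a ha
  have := Finset.mem_range.1 ha
  rw [coeff_C_mul, coeff_eq_zero_of_natDegree_lt, mul_zero]
  rw [natDegree_X_sub_one_pow]
  omega

theorem HNum_one (d : ℕ) : HNum 1 d = FNum 1 (d + 1) := by
  rw [HNum, Nat.add_sub_cancel, coeff_HPoly_self]

theorem neg_one_pow_sub {n a : ℕ} (h : a ≤ n) : (-1 : ℚ) ^ (n - a) = (-1) ^ n * (-1) ^ a := by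
  obtain ⟨c, rfl⟩ := Nat.exists_eq_add_of_le h
  rw [Nat.add_sub_cancel_left, pow_add, mul_right_comm, ← pow_add, Even.neg_one_pow ⟨a, rfl⟩,
    one_mul]

theorem coeff_zero_HPoly {d : ℕ} (hd : 1 ≤ d) : (HPoly d).coeff 0 = 0 := by
  have h := eval_limitPoly_neg_one (n := d + 1) (by omega)
  rw [limitPoly, eval_finsetSum] at h
  rw [coeff_zero_eq_eval_zero, HPoly_eq_sum, eval_finsetSum]
  refine Eq.trans ?_ 
    ((congrArg (fun x => (-1 : ℚ) ^ (d + 1) * x) h).trans (mul_zero _))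
  rw [Finset.mul_sum]
  refine Finset.sum_congr rfl fun a ha => ?_
  have := Finset.mem_range.1 ha
  simp only [eval_mul, eval_C, eval_pow, eval_sub, eval_X, eval_one, zero_sub]
  rw [neg_one_pow_sub (by omega)]
  ring

theorem coeff_one_HPoly {d : ℕ} (hd : 1 ≤ d) : (HPoly d).coeff 1 = FNum 1 (d + 1) := by
  have h := eval_limitPoly_neg_one (n := d + 1) (by omega)
  have h' := eval_derivative_limitPoly (n := d + 1) (by omega)
  have hsq : ((-1 : ℚ) ^ (d + 1)) * (-1) ^ (d + 1) = 1 := by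
    rw [← pow_add, Even.neg_one_pow ⟨d + 1, rfl⟩]
  -- With P the polynomial `limitPoly (d + 1)`, this is the derivative at z = 0 of H(z) = (z -
  -- 1)^(d+1) P(1/(z - 1)), computed termwise.
  have key : (HPoly d).coeff 1 = -(-1) ^ (d + 1) * (d + 1) * (limitPoly (d + 1)).eval (-1) -
      (-1) ^ (d + 1) * (derivative (limitPoly (d + 1))).eval (-1) := by
    have hder : (HPoly d).coeff 1 = (derivative (HPoly d)).eval 0 := by
      rw [← coeff_zero_eq_eval_zero, coeff_derivative]
      simp
    rw [hder, HPoly_eq_sum, limitPoly, derivative_sum, derivative_sum, eval_finsetSum,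
      eval_finsetSum, eval_finsetSum, Finset.mul_sum, Finset.mul_sum, ← Finset.sum_sub_distrib]
    refine Finset.sum_congr rfl fun a ha => ?_
    have ha' : a ≤ d + 1 := by have := Finset.mem_range.1 ha; omega
    have e1 : ∀ m : ℕ, (m : ℚ) * (-1) ^ (m - 1) = -(m * (-1) ^ m) := by
      rintro (_ | m)
      · simp
      · rw [Nat.add_sub_cancel, pow_succ]; ring
    have e2 : (derivative (C (FNum a (d + 1)) * (X - 1) ^ (d + 1 - a))).eval 0 =
        FNum a (d + 1) * (((d + 1 - a : ℕ) : ℚ) * (-1) ^ (d + 1 - a - 1)) := by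
      simp [derivative_pow]
    have e3 : (derivative (C (FNum a (d + 1)) * X ^ a)).eval (-1) =
        FNum a (d + 1) * ((a : ℚ) * (-1) ^ (a - 1)) := by
      simp only [derivative_C_mul, derivative_X_pow, eval_mul, eval_C, eval_pow, eval_X]
    rw [e2, e3, e1, e1, neg_one_pow_sub ha', Nat.cast_sub ha', eval_mul, eval_C, eval_pow, eval_X]
    push_cast
    ring
  rw [key, h, h']
  linear_combination FNum 1 (d + 1) * hsq

end Subdivision

/-! ### Continuity of roots, including one root escaping to infinity. -/

namespace Polynomial

/-- Coefficientwise convergence of a sequence of complex polynomials. -/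
def CoeffTendsto (p : ℕ → ℂ[X]) (q : ℂ[X]) : Prop :=
  ∀ n : ℕ, Tendsto (fun k => (p k).coeff n) atTop (𝓝 (q.coeff n))

theorem CoeffTendsto.tendsto_eval {p : ℕ → ℂ[X]} {q : ℂ[X]} (h : CoeffTendsto p q) {N : ℕ}
    (hp : ∀ k, (p k).natDegree ≤ N) (z : ℂ) :
    Tendsto (fun k => (p k).eval z) atTop (𝓝 (q.eval z)) := by
  have hq : q.natDegree ≤ N := by
    refine natDegree_le_iff_coeff_eq_zero.2 fun n hn => ?_
    refine tendsto_nhds_unique (h n) ?_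
    simp only [fun k => coeff_eq_zero_of_natDegree_lt ((hp k).trans_lt hn)]
    exact tendsto_const_nhds
  rw [eval_eq_sum_range' (Nat.lt_succ_of_le hq)]
  simp only [fun k => eval_eq_sum_range' (Nat.lt_succ_of_le (hp k)) z]
  exact tendsto_finsetSum _ fun i _ => (h i).mul_const _

/-- Dividing out a convergent root preserves coefficientwise convergence. -/
theorem CoeffTendsto.of_X_sub_C_mul {q : ℕ → ℂ[X]} {q' : ℂ[X]} {r : ℕ → ℂ} {r' : ℂ}
    (hr : Tendsto r atTop (𝓝 r'))
    (h : CoeffTendsto (fun k => (X - C (r k)) * q k) ((X - C r') * q')) {N : ℕ}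
    (hq : ∀ k, (q k).natDegree ≤ N) (hq' : q'.natDegree ≤ N) : CoeffTendsto q q' := by
  -- Synthetic division: coefficients of the quotient are recovered from the top down, starting
  -- above the degree bound `N`.
  have hrec : ∀ (p : ℂ[X]) (s : ℂ) (i : ℕ),
      p.coeff i = ((X - C s) * p).coeff (i + 1) + s * p.coeff (i + 1) := by
    intro p s i
    rw [sub_mul, coeff_sub, coeff_X_mul, coeff_C_mul]
    ring
  have hlarge : ∀ i, N < i → Tendsto (fun k => (q k).coeff i) atTop (𝓝 (q'.coeff i)) := by
    intro i hi
    simp only [fun k => coeff_eq_zero_of_natDegree_lt ((hq k).trans_lt hi),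
      coeff_eq_zero_of_natDegree_lt (hq'.trans_lt hi)]
    exact tendsto_const_nhds
  have hall : ∀ m i, N < i + m → Tendsto (fun k => (q k).coeff i) atTop (𝓝 (q'.coeff i)) := by
    intro m
    induction m with
    | zero => exact hlarge
    | succ m ih =>
      intro i hi
      rw [hrec q' r' i]
      simp only [fun k => hrec (q k) (r k) i]
      exact (h (i + 1)).add (hr.mul (ih (i + 1) (by omega)))
  exact fun i => hall (N + 1) i (by omega)

theorem natDegree_prod_X_sub_C {ι : Type*} [Fintype ι] (w : ι → ℂ) :
    (∏ i, (X - C (w i))).natDegree = Fintype.card ι := by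
  rw [natDegree_prod_of_monic _ _ fun i _ => monic_X_sub_C (w i)]
  simp

/-- The root of least modulus tends to zero if the product of the roots does. -/
theorem tendsto_zero_of_norm_le_of_prod {m : ℕ} (hm : m ≠ 0) {w : ℕ → Fin m → ℂ} {v : ℕ → ℂ}
    (hv : ∀ k i, ‖v k‖ ≤ ‖w k i‖) (hw : Tendsto (fun k => ∏ i, w k i) atTop (𝓝 0)) :
    Tendsto v atTop (𝓝 0) := by
  rw [tendsto_zero_iff_norm_tendsto_zero]
  have h1 : Tendsto (fun k => ‖v k‖ ^ m) atTop (𝓝 0) := by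
    refine squeeze_zero (fun k => by positivity) (fun k => ?_)
      (tendsto_zero_iff_norm_tendsto_zero.1 hw)
    rw [norm_prod, ← Fin.prod_const]
    exact Finset.prod_le_prod (fun _ _ => norm_nonneg _) fun i _ => hv k i
  have h2 := h1.rpow_const (p := (m : ℝ)⁻¹) (Or.inr (by positivity))
  rw [Real.zero_rpow (by positivity)] at h2
  simpa only [fun k => Real.pow_rpow_inv_natCast (norm_nonneg (v k)) hm] using h2

/-- Continuity of the roots: if monic polynomials converge coefficientwise, their roots can be
numbered so that they converge to the roots of the limit. -/
theorem exists_perm_tendsto_roots {m : ℕ} (w : ℕ → Fin m → ℂ) (θ : Fin m → ℂ)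
    (h : CoeffTendsto (fun k => ∏ i, (X - C (w k i))) (∏ i, (X - C (θ i)))) :
    ∃ σ : ℕ → Equiv.Perm (Fin m), ∀ i, Tendsto (fun k => w k (σ k i)) atTop (𝓝 (θ i)) := by
  induction m with
  | zero => exact ⟨fun _ => 1, fun i => i.elim0⟩
  | succ m ih =>
    -- Choose the root closest to `θ 0`: the product of all distances to `θ 0` tends to 0, hence so
    -- does the least one. The induction continues after dividing it out.
    have hmin : ∀ k, ∃ i, ∀ j, ‖θ 0 - w k i‖ ≤ ‖θ 0 - w k j‖ := fun k =>
      Finite.exists_min fun i => ‖θ 0 - w k i‖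
    choose i hi using hmin
    have heval := h.tendsto_eval (fun k => (natDegree_prod_X_sub_C (w k)).le) (θ 0)
    simp only [eval_prod, eval_sub, eval_X, eval_C] at heval
    rw [Finset.prod_eq_zero (Finset.mem_univ 0) (sub_self (θ 0))] at heval
    have h0 : Tendsto (fun k => w k (i k)) atTop (𝓝 (θ 0)) := by
      have := tendsto_zero_of_norm_le_of_prod (Nat.succ_ne_zero m) hi heval
      simpa using this.const_sub (θ 0)
    set w' : ℕ → Fin m → ℂ := fun k j => w k (Equiv.swap 0 (i k) j.succ) with hw'
    have hfac : ∀ k, ∏ j, (X - C (w k j)) =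
        (X - C (w k (i k))) * ∏ j, (X - C (w' k j)) := by
      intro k
      rw [← Equiv.prod_comp (Equiv.swap 0 (i k)), Fin.prod_univ_succ, Equiv.swap_apply_left]
    rw [Fin.prod_univ_succ] at h
    simp only [hfac] at h
    obtain ⟨σ, hσ⟩ := ih w' (fun j => θ j.succ) (h.of_X_sub_C_mul h0
      (fun k => (natDegree_prod_X_sub_C (w' k)).le) (natDegree_prod_X_sub_C _).le)
    refine ⟨fun k => Equiv.swap 0 (i k) * Equiv.Perm.decomposeFin.symm (0, σ k), fun j => ?_⟩
    induction j using Fin.cases with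
    | zero => simpa using h0
    | succ j => simpa [hw'] using hσ j

/-- Rescaling the roots turns a family with vanishing normalizing factor into a convergent monic
family. -/
theorem coeff_prod_X_sub_C_smul {m : ℕ} (ε : ℂ) (w : Fin m → ℂ) (j : ℕ) :
    (∏ i, (X - C (ε * w i))).coeff j = ε ^ (m - j) * (∏ i, (X - C (w i))).coeff j := by
  have h : ∏ i, (X - C (ε * w i)) = (∏ i, (X - C (w i))).scaleRoots ε := by
    induction m with
    | zero => simp
    | succ m ih =>
      rw [Fin.prod_univ_succ, Fin.prod_univ_succ, mul_scaleRoots_of_noZeroDivisors, ih]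
      rw [X_sub_C_scaleRoots, mul_comm ε]
  rw [h, coeff_scaleRoots, natDegree_prod_X_sub_C, Fintype.card_fin, mul_comm]

/-- A family of monic polynomials which, suitably scaled, converges to a polynomial of one degree
less: exactly one root escapes to infinity. -/
theorem tendsto_mul_of_norm_le {d : ℕ} {ε : ℕ → ℂ} (hε : Tendsto ε atTop (𝓝 0))
    (w : ℕ → Fin (d + 1) → ℂ) {H : ℂ[X]} (hH0 : H.coeff d ≠ 0)
    (hmax : ∀ k i, ‖w k i‖ ≤ ‖w k 0‖)
    (h : CoeffTendsto (fun k => C (ε k) * ∏ i, (X - C (w k i))) H) :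
    Tendsto (fun k => ε k * w k 0) atTop (𝓝 (-H.coeff d)) := by
  -- After scaling the roots by `ε`, the coefficients below degree `d` carry extra powers of `ε` and
  -- vanish in the limit, which is `X ^ d * (X + H_d)` with `H_d = H.coeff d`.
  set θ : Fin (d + 1) → ℂ := Fin.cons (-H.coeff d) (fun _ => 0) with hθ
  have hprod : ∏ i, (X - C (θ i)) = X ^ (d + 1) + C (H.coeff d) * X ^ d := by
    rw [Fin.prod_univ_succ]
    simp [hθ]
    ring
  have hscaled : CoeffTendsto (fun k => ∏ i, (X - C (ε k * w k i))) (∏ i, (X - C (θ i))) := by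
    intro j
    rcases lt_trichotomy j d with hj | rfl | hj
    · have h0 : (∏ i, (X - C (θ i))).coeff j = 0 := by
        rw [hprod, coeff_add, coeff_X_pow, coeff_C_mul, coeff_X_pow, if_neg (by omega),
          if_neg (by omega), mul_zero, add_zero]
      rw [h0]
      have := (hε.pow (d - j)).mul (h j)
      rw [zero_pow (by omega), zero_mul] at this
      refine this.congr fun k => ?_
      rw [coeff_C_mul, coeff_prod_X_sub_C_smul, ← mul_assoc, ← pow_succ]
      congr 2
      omega
    · have h0 : (∏ i, (X - C (θ i))).coeff j = H.coeff j := by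
        rw [hprod, coeff_add, coeff_X_pow, coeff_C_mul, coeff_X_pow, if_neg (by omega),
          if_pos rfl, mul_one, zero_add]
      rw [h0]
      refine (h j).congr fun k => ?_
      rw [coeff_C_mul, coeff_prod_X_sub_C_smul, Nat.add_sub_cancel_left, pow_one]
    · have hc : ∀ u : Fin (d + 1) → ℂ, (∏ i, (X - C (u i))).coeff j =
          if j = d + 1 then 1 else 0 := by
        intro u
        have hu := natDegree_prod_X_sub_C u
        rw [Fintype.card_fin] at hu
        split_ifs with hj'
        · have := (monic_prod_of_monic Finset.univ _ fun i _ => monic_X_sub_C (u i)).coeff_natDegree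
          rw [hu] at this
          exact (congrArg _ hj').trans this
        · exact coeff_eq_zero_of_natDegree_lt (by omega)
      simp only [hc]
      exact tendsto_const_nhds
  obtain ⟨σ, hσ⟩ := exists_perm_tendsto_roots _ θ hscaled
  have hpos : 0 < ‖H.coeff d‖ / 2 := by positivity
  have hbig : ∀ᶠ k in atTop, ‖H.coeff d‖ / 2 < ‖ε k * w k (σ k 0)‖ := by
    refine (hσ 0).norm.eventually_const_lt ?_
    simp only [hθ, Fin.cons_zero, norm_neg]
    linarith
  have hsmall : ∀ᶠ k in atTop, ∀ i : Fin d, ‖ε k * w k (σ k i.succ)‖ < ‖H.coeff d‖ / 2 := by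
    refine eventually_all.2 fun i => (hσ i.succ).norm.eventually_lt_const ?_
    simpa [hθ] using hH0
  -- Only one scaled root stays away from 0, so it must be the one of maximal modulus, at index 0.
  have heq : ∀ᶠ k in atTop, σ k 0 = 0 := by
    filter_upwards [hbig, hsmall] with k h1 h2
    obtain ⟨i, hi⟩ := (σ k).surjective 0
    induction i using Fin.cases with
    | zero => exact hi
    | succ i =>
      have h3 := h2 i
      rw [hi] at h3
      have h4 : ‖ε k * w k (σ k 0)‖ ≤ ‖ε k * w k 0‖ := by
        rw [norm_mul, norm_mul]
        exact mul_le_mul_of_nonneg_left (hmax k _) (norm_nonneg _)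
      linarith
  have h0 := hσ 0
  simp only [hθ, Fin.cons_zero] at h0
  refine h0.congr' ?_
  filter_upwards [heq] with k hk
  rw [hk]

/-- Dividing out a root escaping to infinity. -/
theorem CoeffTendsto.of_C_mul_X_sub_C_mul {ε r : ℕ → ℂ} (hε : Tendsto ε atTop (𝓝 0)) {c : ℂ}
    (hc : c ≠ 0) (hr : Tendsto (fun k => ε k * r k) atTop (𝓝 (-c))) {q : ℕ → ℂ[X]} {L : ℂ[X]}
    (h : CoeffTendsto (fun k => C (ε k) * ((X - C (r k)) * q k)) (C c * L)) :
    CoeffTendsto q L := by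
  have hev : ∀ᶠ k in atTop, ε k * r k ≠ 0 := hr.eventually_ne (neg_ne_zero.2 hc)
  -- Since `ε * r` has a nonzero limit, each coefficient of `q` can be solved for from the preceding
  -- one, upward from the constant term.
  intro i
  induction i with
  | zero =>
    have h1 := (h 0).div (hr.neg) (by simpa using hc)
    rw [coeff_C_mul, neg_neg, mul_div_cancel_left₀ _ hc] at h1
    refine h1.congr' ?_
    filter_upwards [hev] with k hk
    rw [Pi.div_apply, coeff_C_mul, mul_coeff_zero, coeff_sub, coeff_X_zero, coeff_C_zero]
    field_simp [left_ne_zero_of_mul hk, right_ne_zero_of_mul hk]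
    ring
  | succ i ih =>
    have h1 := ((h (i + 1)).sub (hε.mul ih)).div (hr.neg) (by simpa using hc)
    rw [coeff_C_mul, neg_neg, zero_mul, sub_zero, mul_div_cancel_left₀ _ hc] at h1
    refine h1.congr' ?_
    filter_upwards [hev] with k hk
    rw [Pi.div_apply, coeff_C_mul, sub_mul, coeff_sub, coeff_X_mul, coeff_C_mul]
    field_simp [left_ne_zero_of_mul hk, right_ne_zero_of_mul hk]
    ring

end Polynomial

/-! ### Asymptotics of the face numbers and the `h`-polynomials. -/

theorem tendsto_zero_of_contraction {r : ℝ} (hr0 : 0 ≤ r) (hr1 : r < 1) {z δ : ℕ → ℝ}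
    (hz : ∀ k, z (k + 1) = r * z k + δ k) (hδ : Tendsto δ atTop (𝓝 0)) :
    Tendsto z atTop (𝓝 0) := by
  rw [Metric.tendsto_atTop]
  intro η hη
  -- The tolerance makes `η / 2` the fixed point of `x ↦ r * x + η / 2 * (1 - r)`.
  obtain ⟨K, hK⟩ := Metric.tendsto_atTop.1 hδ (η / 2 * (1 - r)) (by nlinarith)
  have hbound : ∀ m, |z (K + m)| ≤ r ^ m * |z K| + η / 2 := by
    intro m
    induction m with
    | zero => simpa using (half_pos hη).le
    | succ m ih =>
      have h1 := hK (K + m) (by omega)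
      rw [Real.dist_eq, sub_zero] at h1
      rw [← add_assoc, hz]
      calc |r * z (K + m) + δ (K + m)| ≤ r * |z (K + m)| + |δ (K + m)| := by
            refine (abs_add_le _ _).trans ?_
            rw [abs_mul, abs_of_nonneg hr0]
        _ ≤ r * (r ^ m * |z K| + η / 2) + η / 2 * (1 - r) := by gcongr
        _ = r ^ (m + 1) * |z K| + η / 2 := by ring
  have hgeom : Tendsto (fun m => r ^ m * |z K|) atTop (𝓝 0) := by
    simpa using (tendsto_pow_atTop_nhds_zero_of_lt_one hr0 hr1).mul_const |z K|
  obtain ⟨M, hM⟩ := eventually_atTop.1 (hgeom.eventually_lt_const (half_pos hη))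
  refine ⟨K + M, fun k hk => ?_⟩
  obtain ⟨m, rfl⟩ := Nat.exists_eq_add_of_le (show K ≤ k by omega)
  rw [Real.dist_eq, sub_zero]
  have h1 := hbound m
  have h2 := hM m (by omega)
  linarith

theorem tendsto_of_contraction {r e L : ℝ} (hr0 : 0 ≤ r) (hr1 : r < 1) {y δ : ℕ → ℝ}
    (hy : ∀ k, y (k + 1) = r * y k + δ k) (hδ : Tendsto δ atTop (𝓝 e)) (hL : L = r * L + e) :
    Tendsto y atTop (𝓝 L) := by
  rw [← tendsto_sub_nhds_zero_iff]
  refine tendsto_zero_of_contraction hr0 hr1 (δ := fun k => δ k - e) (fun k => ?_) ?_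
  · rw [hy]
    linear_combination -hL
  · simpa using hδ.sub_const e

namespace PreAbstractSimplicialComplex
open Subdivision

/-- The growth of the face numbers under iterated subdivision. -/
theorem tendsto_numSimplices_iterSubdivision {ι : Type*} (Δ : PreAbstractSimplicialComplex ι)
    (hfin : Δ.faces.Finite) {n : ℕ} (hn : 2 ≤ n) (h : Δ.maxCard = n) {a : ℕ} (ha : a ≤ n) :
    Tendsto (fun k => ((Δ.iterSubdivision k).numSimplices a : ℝ) / (n.factorial : ℝ) ^ k) atTop
      (𝓝 (Δ.numSimplices n * (FNum a n : ℝ))) := by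
  have hn0 : (n.factorial : ℝ) ≠ 0 := by positivity
  have hrec : ∀ a ≤ n, ∀ k,
      ((Δ.iterSubdivision (k + 1)).numSimplices a : ℝ) / (n.factorial : ℝ) ^ (k + 1) =
      (a.factorial / n.factorial : ℝ) *
        (((Δ.iterSubdivision k).numSimplices a : ℝ) / (n.factorial : ℝ) ^ k) +
      (n.factorial : ℝ)⁻¹ * ∑ c ∈ Finset.Ioc a n, (chainCount a c : ℝ) *
        (((Δ.iterSubdivision k).numSimplices c : ℝ) / (n.factorial : ℝ) ^ k) := by
    intro a ha k
    have h1 := sum_chainCount_mul_eq (R := ℝ) ha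
      fun b => ((Δ.iterSubdivision k).numSimplices b : ℝ)
    rw [Δ.numSimplices_iterSubdivision_succ hfin (by omega) h k a]
    push_cast
    rw [Finset.sum_congr rfl fun b _ => mul_comm _ _, h1]
    simp only [mul_div_assoc', ← Finset.sum_div]
    field_simp
    ring
  -- Descending in `a`: the normalized top face number is constant, and each lower one satisfies a
  -- contraction with factor `a! / n!`, driven by larger indices.
  induction hm : n - a using Nat.strong_induction_on generalizing a with
  | _ m ih =>
    rcases ha.eq_or_lt with rfl | hlt
    · have hconst : ∀ k, ((Δ.iterSubdivision k).numSimplices a : ℝ) / (a.factorial : ℝ) ^ k =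
          Δ.numSimplices a := by
        intro k
        induction k with
        | zero => simp [iterSubdivision, IterVertex]
        | succ k ihk =>
          rw [hrec a le_rfl k, ihk, Finset.Ioc_self, Finset.sum_empty, mul_zero, add_zero,
            div_self hn0, one_mul]
      simp only [hconst, FNum_self, Rat.cast_one, mul_one]
      exact tendsto_const_nhds
    · have hfac : (a.factorial : ℝ) < n.factorial := by exact_mod_cast factorial_lt_of_lt hn hlt
      refine tendsto_of_contraction (by positivity) ((div_lt_one (by positivity)).2 hfac)
        (hrec a ha) ((tendsto_finsetSum _ fun c hc => (ih (n - c) ?_ (Finset.mem_Ioc.1 hc).2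
          rfl).const_mul _).const_mul _) ?_
      · have := Finset.mem_Ioc.1 hc
        omega
      -- The fixed-point equation for the limit is the eigenvector equation.
      · have h1 := congrArg (Rat.cast : ℚ → ℝ) (factorial_sub_mul_FNum hn hlt)
        push_cast at h1
        have h2 : ∑ c ∈ Finset.Ioc a n, (chainCount a c : ℝ) *
            ((Δ.numSimplices n : ℝ) * (FNum c n : ℝ)) = (Δ.numSimplices n : ℝ) *
              ∑ c ∈ Finset.Ioc a n, (chainCount a c : ℝ) * (FNum c n : ℝ) := by
          rw [Finset.mul_sum]
          exact Finset.sum_congr rfl fun c _ => by ring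
        rw [h2, ← h1]
        field_simp
        ring

theorem map_hPoly {ι : Type*} (Δ : PreAbstractSimplicialComplex ι) {n : ℕ}
    (h : Δ.maxCard = n) : Δ.hPoly.map (Int.castRingHom ℂ) =
      ∑ a ∈ Finset.range (n + 1), C (Δ.numSimplices a : ℂ) * (X - 1) ^ (n - a) := by
  rw [hPoly, fPoly, h, sum_comp, Polynomial.map_sum]
  refine Finset.sum_congr rfl fun a _ => ?_
  simp

theorem natDegree_X_sub_one_pow (m : ℕ) : ((X - 1 : ℂ[X]) ^ m).natDegree = m := by
  have h : (X - 1 : ℂ[X]) = X - C 1 := by simp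
  rw [h, natDegree_pow, natDegree_X_sub_C, mul_one]

theorem monic_map_hPoly {ι : Type*} (Δ : PreAbstractSimplicialComplex ι) :
    (Δ.hPoly.map (Int.castRingHom ℂ)).Monic := by
  have hm : ((X - 1 : ℂ[X]) ^ Δ.maxCard).Monic := by
    have h : (X - 1 : ℂ[X]) = X - C 1 := by simp
    rw [h]
    exact (monic_X_sub_C 1).pow _
  rw [map_hPoly Δ rfl, Finset.sum_range_succ', numSimplices_zero, Nat.cast_one, C_1, one_mul,
    Nat.sub_zero]
  rcases Nat.eq_zero_or_pos Δ.maxCard with h0 | h0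
  · simp [h0]
  refine hm.add_of_right ?_
  rw [degree_eq_natDegree hm.ne_zero, natDegree_X_sub_one_pow]
  refine (degree_sum_le _ _).trans_lt ((Finset.sup_lt_iff (WithBot.bot_lt_coe _)).2 fun a _ => ?_)
  refine degree_le_natDegree.trans_lt ?_
  refine Nat.cast_lt.2 ((natDegree_C_mul_le _ _).trans_lt ?_)
  rw [natDegree_X_sub_one_pow]
  omega

/-- The normalized `h`-polynomials of the iterated subdivisions converge to the
`H`-polynomial. -/
theorem coeffTendsto_hPoly {ι : Type*} (Δ : PreAbstractSimplicialComplex ι)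
    (hfin : Δ.faces.Finite) {d : ℕ} (hd : 1 ≤ d) (h : Δ.maxCard = d + 1) :
    CoeffTendsto (fun k => C ((Δ.numSimplices (d + 1) * ((d + 1).factorial : ℂ) ^ k)⁻¹) *
      (Δ.iterSubdivision k).hPoly.map (Int.castRingHom ℂ))
      ((HPoly d).map (algebraMap ℚ ℂ)) := by
  intro j
  have hpos : (Δ.numSimplices (d + 1) : ℝ) ≠ 0 := by
    exact_mod_cast ((Δ.maxCard_eq_iff hfin (Nat.succ_ne_zero d)).1 h).2
  have hlim : ((HPoly d).map (algebraMap ℚ ℂ)).coeff j =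
      ∑ a ∈ Finset.range (d + 2), (((FNum a (d + 1) : ℚ) : ℝ) : ℂ) *
        ((X - 1 : ℂ[X]) ^ (d + 1 - a)).coeff j := by
    rw [HPoly_eq_sum, Polynomial.map_sum, finsetSum_coeff]
    refine Finset.sum_congr rfl fun a _ => ?_
    rw [Polynomial.map_mul, map_C, coeff_C_mul]
    simp
  rw [hlim]
  have hk : ∀ k, (C ((Δ.numSimplices (d + 1) * ((d + 1).factorial : ℂ) ^ k)⁻¹) *
      (Δ.iterSubdivision k).hPoly.map (Int.castRingHom ℂ)).coeff j =
      ∑ a ∈ Finset.range (d + 2), (((Δ.numSimplices (d + 1) : ℝ)⁻¹ *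
        (((Δ.iterSubdivision k).numSimplices a : ℝ) / ((d + 1).factorial : ℝ) ^ k) : ℝ) : ℂ) *
        ((X - 1 : ℂ[X]) ^ (d + 1 - a)).coeff j := by
    intro k
    rw [map_hPoly _ (Δ.maxCard_iterSubdivision hfin (Nat.succ_ne_zero d) h k), coeff_C_mul,
      finsetSum_coeff, Finset.mul_sum]
    refine Finset.sum_congr rfl fun a _ => ?_
    rw [coeff_C_mul]
    push_cast
    rw [mul_inv]
    ring
  simp only [hk]
  refine tendsto_finsetSum _ fun a ha => Tendsto.mul_const _ ?_
  refine (Complex.continuous_ofReal.tendsto _).comp ?_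
  have h1 := (Δ.tendsto_numSimplices_iterSubdivision hfin (n := d + 1) (by omega) h
    (a := a) (by have := Finset.mem_range.1 ha; omega)).const_mul (Δ.numSimplices (d + 1) : ℝ)⁻¹
  rwa [inv_mul_cancel_left₀ hpos] at h1

end PreAbstractSimplicialComplex

/-! ### Factorization over ℂ, conjugate roots, and the main theorem. -/

namespace Polynomial

theorem exists_eq_prod_X_sub_C {p : ℂ[X]} (hp : p.Monic) {m : ℕ} (hm : p.natDegree = m) :
    ∃ θ : Fin m → ℂ, p = ∏ i, (X - C (θ i)) := by
  have hs := IsAlgClosed.splits p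
  have hcard : p.roots.toList.length = m := by
    rw [Multiset.length_toList, ← hm, hs.natDegree_eq_card_roots]
  subst hcard
  refine ⟨p.roots.toList.get, ?_⟩
  conv_lhs => rw [hs.eq_prod_roots_of_monic hp, ← Multiset.coe_toList p.roots, Multiset.map_coe,
    Multiset.prod_coe]
  exact (Fin.prod_univ_fun_getElem _ _).symm

theorem conj_mem_roots_map_intCast {p : ℤ[X]} {z : ℂ}
    (hz : z ∈ (p.map (Int.castRingHom ℂ)).roots) :
    (starRingEnd ℂ) z ∈ (p.map (Int.castRingHom ℂ)).roots := by
  rw [mem_roots'] at hz ⊢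
  refine ⟨hz.1, ?_⟩
  have h := congrArg (starRingEnd ℂ) hz.2.eq_zero
  rw [eval_map, hom_eval₂, map_zero] at h
  rw [IsRoot.def, eval_map]
  rwa [Subsingleton.elim ((starRingEnd ℂ).comp (Int.castRingHom ℂ)) (Int.castRingHom ℂ)] at h

end Polynomial

theorem theorem1 {ι : Type*} (Δ : PreAbstractSimplicialComplex ι) (hfin : Δ.faces.Finite)
    (d : ℕ) (hd : 1 ≤ d) (hdim : Δ.dim = (d : ℤ))
    (ρinf ρ0 : ℕ → ℂ) (ρ : ℕ → Fin (d - 1) → ℂ)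
    (hroots : ∀ k : ℕ, ((Δ.iterSubdivision k).hPoly.map (Int.castRingHom ℂ)).roots =
      ρinf k ::ₘ ρ0 k ::ₘ (Finset.univ : Finset (Fin (d - 1))).val.map (ρ k))
    (hextr : ∀ k : ℕ, ∀ z ∈ ((Δ.iterSubdivision k).hPoly.map (Int.castRingHom ℂ)).roots,
      ‖ρ0 k‖ ≤ ‖z‖ ∧ ‖z‖ ≤ ‖ρinf k‖) :
    Tendsto ρ0 atTop (𝓝 0) ∧
    (∃ (σ : ℕ → Equiv.Perm (Fin (d - 1))) (θ : Fin (d - 1) → ℂ),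
      ∀ i, Tendsto (fun k => ρ k (σ k i)) atTop (𝓝 (θ i))) ∧
    (∀ᶠ k in atTop, (ρinf k).im = 0) ∧
    Tendsto (fun k => ‖ρinf k‖) atTop atTop ∧
    (∃ L : ℂ[X],
      (∀ n : ℕ, Tendsto (fun k => ((X - C (ρ0 k)) * ∏ i, (X - C (ρ k i))).coeff n)
        atTop (𝓝 (L.coeff n))) ∧
      (∀ z : ℂ, Tendsto (fun k => (z - ρ0 k) * ∏ i, (z - ρ k i)) atTop (𝓝 (L.eval z))) ∧
      C ((Subdivision.HNum 1 d : ℚ) : ℂ) * L =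
        (Subdivision.HPoly d).map (algebraMap ℚ ℂ)) ∧
    Tendsto (fun k => ∏ i, ρ k i) atTop (𝓝 ((-1) ^ (d - 1))) := by
  obtain ⟨e, rfl⟩ : ∃ e, d = e + 1 := ⟨d - 1, by omega⟩
  change ℕ → Fin e → ℂ at ρ
  change _ ∧ (∃ (σ : ℕ → Equiv.Perm (Fin e)) (θ : Fin e → ℂ), _) ∧ _ ∧ _ ∧ _ ∧
    Tendsto _ _ (𝓝 ((-1) ^ e))
  have hmax : Δ.maxCard = e + 1 + 1 := by
    rw [PreAbstractSimplicialComplex.dim] at hdim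
    push_cast at hdim
    omega
  set P : ℕ → ℂ[X] := fun k => (Δ.iterSubdivision k).hPoly.map (Int.castRingHom ℂ) with hP
  set ε : ℕ → ℂ := fun k =>
    (Δ.numSimplices (e + 1 + 1) * ((e + 1 + 1).factorial : ℂ) ^ k)⁻¹ with hε
  set H : ℂ[X] := (Subdivision.HPoly (e + 1)).map (algebraMap ℚ ℂ) with hH
  set c : ℂ := ((Subdivision.FNum 1 (e + 1 + 1) : ℚ) : ℂ) with hc
  have hc0 : c ≠ 0 := by
    rw [hc]
    exact_mod_cast (Subdivision.FNum_one_pos (by omega : 2 ≤ e + 1 + 1)).ne'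
  have hHc : H.coeff (e + 1) = c := by
    rw [hH, coeff_map, Subdivision.coeff_HPoly_self]
    rfl
  have hH0 : H.coeff 0 = 0 := by
    rw [hH, coeff_map, Subdivision.coeff_zero_HPoly (by omega), map_zero]
  have hH1 : H.coeff 1 = c := by
    rw [hH, coeff_map, Subdivision.coeff_one_HPoly (by omega)]
    rfl
  have hHdeg : H.natDegree ≤ e + 1 := natDegree_map_le.trans Subdivision.natDegree_HPoly_le
  have hfacets : (Δ.numSimplices (e + 1 + 1) : ℝ) ≠ 0 := by
    exact_mod_cast ((Δ.maxCard_eq_iff hfin (Nat.succ_ne_zero _)).1 hmax).2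
  have hεinv : Tendsto (fun k => ‖ε k‖⁻¹) atTop atTop := by
    have h1 : (1 : ℝ) < (e + 1 + 1).factorial := by
      exact_mod_cast Nat.one_lt_factorial.2 (by omega)
    have h2 := (tendsto_pow_atTop_atTop_of_one_lt h1).const_mul_atTop
      (lt_of_le_of_ne (Nat.cast_nonneg _) hfacets.symm)
    refine h2.congr fun k => ?_
    simp [hε]
  have hε0 : Tendsto ε atTop (𝓝 0) := by
    rw [tendsto_zero_iff_norm_tendsto_zero]
    refine hεinv.inv_tendsto_atTop.congr fun k => ?_
    rw [Pi.inv_apply, inv_inv]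
  have hlim : CoeffTendsto (fun k => C (ε k) * P k) H :=
    Δ.coeffTendsto_hPoly hfin (by omega) hmax
  set w' : ℕ → Fin (e + 1) → ℂ := fun k => Fin.cons (ρ0 k) (ρ k) with hw'
  set w : ℕ → Fin (e + 1 + 1) → ℂ := fun k => Fin.cons (ρinf k) (w' k) with hw
  have hPw : ∀ k, P k = ∏ i, (X - C (w k i)) := by
    intro k
    have h1 := (IsAlgClosed.splits (P k)).eq_prod_roots_of_monic
      (PreAbstractSimplicialComplex.monic_map_hPoly _)
    rw [h1, hroots k]
    rw [Multiset.map_cons, Multiset.map_cons, Multiset.map_map, Multiset.prod_cons,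
      Multiset.prod_cons, Fin.prod_univ_succ, Fin.prod_univ_succ]
    rfl
  have hmem' : ∀ k i, w' k i ∈ (P k).roots := by
    intro k i
    rw [hroots k]
    induction i using Fin.cases with
    | zero => simp [hw']
    | succ i => exact Multiset.mem_cons_of_mem (Multiset.mem_cons_of_mem
        (Multiset.mem_map.2 ⟨i, by simp, by simp [hw']⟩))
  have hmem : ∀ k i, w k i ∈ (P k).roots := by
    intro k i
    induction i using Fin.cases with
    | zero =>
      rw [hroots k]
      simp [hw]
    | succ i => exact hmem' k i
  have hdom : ∀ k i, ‖w k i‖ ≤ ‖w k 0‖ := fun k i => (hextr k _ (hmem k i)).2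
  have hερ : Tendsto (fun k => ε k * ρinf k) atTop (𝓝 (-c)) := by
    rw [← hHc]
    refine tendsto_mul_of_norm_le hε0 w (hHc ▸ hc0) hdom ?_
    simpa only [← hPw] using hlim
  have hinf : Tendsto (fun k => ‖ρinf k‖) atTop atTop := by
    have h1 := hερ.norm
    rw [norm_neg] at h1
    refine (h1.pos_mul_atTop (norm_pos_iff.2 hc0) hεinv).congr' ?_
    filter_upwards [hεinv.eventually_gt_atTop 0] with k hk
    rw [norm_mul, mul_right_comm, mul_inv_cancel₀ (inv_pos.1 hk).ne', one_mul]
  -- `L'` is `H / (c * X)`, an exact quotient because `H` has no constant term; it is the limit of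
  -- the polynomial with roots `ρ k`.
  set L' : ℂ[X] := C c⁻¹ * H.divX with hL'
  have hL : C c * (X * L') = H := by
    have h1 := H.divX_mul_X_add
    rw [hH0, C_0, add_zero] at h1
    rw [hL', mul_left_comm X, ← mul_assoc, ← C_mul, mul_inv_cancel₀ hc0, C_1, one_mul, mul_comm, h1]
  have hq : CoeffTendsto (fun k => ∏ i, (X - C (w' k i))) (X * L') := by
    refine CoeffTendsto.of_C_mul_X_sub_C_mul hε0 hc0 hερ ?_
    rw [hL]
    simpa only [hPw, hw, Fin.prod_univ_succ (n := e + 1), Fin.cons_zero, Fin.cons_succ] using hlim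
  have hqdeg : ∀ k, (∏ i, (X - C (w' k i))).natDegree ≤ e + 1 := fun k => by
    rw [natDegree_prod_X_sub_C, Fintype.card_fin]
  have hρ0 : Tendsto ρ0 atTop (𝓝 0) := by
    have h1 := hq.tendsto_eval hqdeg 0
    simp only [eval_prod, eval_sub, eval_X, eval_C, eval_mul, zero_mul, zero_sub] at h1
    refine tendsto_zero_of_norm_le_of_prod (Nat.succ_ne_zero e) (fun k i => ?_) h1
    rw [norm_neg]
    exact (hextr k _ (hmem' k i)).1
  have hprod' : ∀ k, ∏ i, (X - C (w' k i)) = (X - C (ρ0 k)) * ∏ i, (X - C (ρ k i)) := by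
    intro k
    rw [Fin.prod_univ_succ]
    simp [hw']
  have hL'coeff : ∀ i, L'.coeff i = c⁻¹ * H.coeff (i + 1) := by
    intro i
    rw [hL', coeff_C_mul, coeff_divX]
  have hL'deg : L'.natDegree ≤ e := by
    refine natDegree_le_iff_coeff_eq_zero.2 fun i hi => ?_
    rw [hL'coeff, coeff_eq_zero_of_natDegree_lt (by omega), mul_zero]
  have hL'lead : L'.coeff e = 1 := by rw [hL'coeff, hHc, inv_mul_cancel₀ hc0]
  have hL'nat : L'.natDegree = e :=
    natDegree_eq_of_le_of_coeff_ne_zero hL'deg (by rw [hL'lead]; exact one_ne_zero)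
  have hL'monic : L'.Monic := by rw [Monic, leadingCoeff, hL'nat, hL'lead]
  have hq' : CoeffTendsto (fun k => ∏ i, (X - C (ρ k i))) L' := by
    refine CoeffTendsto.of_X_sub_C_mul hρ0 (N := e) ?_ (fun k => ?_) hL'deg
    · rw [C_0, sub_zero]
      simpa only [hprod'] using hq
    · rw [natDegree_prod_X_sub_C, Fintype.card_fin]
  obtain ⟨θ, hθ⟩ := exists_eq_prod_X_sub_C hL'monic hL'nat
  obtain ⟨σ, hσ⟩ := exists_perm_tendsto_roots ρ θ (hθ ▸ hq')
  refine ⟨hρ0, ⟨σ, θ, hσ⟩, ?_, hinf, ⟨X * L', ?_, ?_, ?_⟩, ?_⟩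
  -- All other roots are eventually smaller than `ρinf k` in modulus, whereas its conjugate is a
  -- root of equal modulus.
  · have hb : ∀ᶠ k in atTop, ∀ i, ‖ρ k (σ k i)‖ < ‖ρinf k‖ := by
      refine eventually_all.2 fun i => ?_
      filter_upwards [(hσ i).norm.eventually_lt_const (lt_add_one ‖θ i‖),
        hinf.eventually_gt_atTop (‖θ i‖ + 1)] with k h1 h2
      exact h1.trans h2
    have hb0 : ∀ᶠ k in atTop, ‖ρ0 k‖ < ‖ρinf k‖ := by
      filter_upwards [hρ0.norm.eventually_lt_const (u := 1) (by simp),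
        hinf.eventually_gt_atTop 1] with k h1 h2
      exact h1.trans h2
    filter_upwards [hb, hb0] with k h1 h2
    have hself : ρinf k ∈ (P k).roots := hmem k 0
    have hconj := conj_mem_roots_map_intCast hself
    rw [hroots k] at hconj
    have hnorm : ‖(starRingEnd ℂ) (ρinf k)‖ = ‖ρinf k‖ := Complex.norm_conj _
    rcases Multiset.mem_cons.1 hconj with h | h
    · exact Complex.conj_eq_iff_im.1 h
    · rcases Multiset.mem_cons.1 h with h | h
      · rw [h] at hnorm
        exact absurd hnorm h2.ne
      · obtain ⟨i, -, hi⟩ := Multiset.mem_map.1 h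
        have h3 := h1 ((σ k).symm i)
        rw [Equiv.apply_symm_apply, hi, hnorm] at h3
        exact absurd h3 (lt_irrefl _)
  · intro n
    have h1 := hq n
    simp only [hprod'] at h1
    exact h1
  · intro z
    have h1 := hq.tendsto_eval hqdeg z
    simp only [hprod', eval_mul, eval_prod, eval_sub, eval_X, eval_C] at h1
    rw [eval_mul, eval_X]
    exact h1
  · rw [Subdivision.HNum_one]
    exact hL
  -- The constant coefficient of `L'` is `H.coeff 1 / c = 1`, by the symmetry; it is the limit of
  -- `(-1) ^ e` times the product of the roots.
  · have h1 := (hq' 0).const_mul ((-1 : ℂ) ^ e)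
    rw [hL'coeff, hH1, inv_mul_cancel₀ hc0, mul_one] at h1
    refine h1.congr fun k => ?_
    rw [coeff_zero_eq_eval_zero, eval_prod, ← Fin.prod_const, ← Finset.prod_mul_distrib]
    exact Finset.prod_congr rfl fun i _ => by simp
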